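/- Words are over the alphabet $\{0,1,2\}$. A factor of an infinite word $w=w_0w_1w_2\cdots$ is a finite block of consecutive letters of $w$, and $w$ is recurrent if each of its factors occurs infinitely many times in $w$; the recurrent factors of $w$ are the finite words that occur infinitely many times in $w$. A formula is a finite list of words (its fragments, separated by dots) over the variables $A,B,C$. An infinite word $w$ avoids a formula $f$ if there is no non-erasing morphism $h:\{A,B,C\}^*\to\{0,1,2\}^*$ (that is, with $h(A),h(B),h(C)$ all non-empty) such that $h(p)$ is a factor of $w$ for every fragment $p$ of $f$. Let $b_3$ be the infinite fixed point of the morphism $0\mapsto 012$, $1\mapsto 02$, $2\mapsto 1$. For $c\in\{0,1,2\}$ let $\sigma_c$ be the letter permutation that fixes $c$ and exchanges the other two letters, applied letterwise to infinite words. **Theorem.** Let $f$ be one of the formulas $$f_b=ABCAB.ABCBA.ACB.BAC,\quad f_1=ABCA.BCAB.BCB.CBA,\quad f_2=ABCAB.BCB.AC,$$ $$f_3=ABCA.BCAB.ACB.BCB,\quad f_4=ABCA.BCAB.BCB.AC.BA.$$ 1. Every recurrent infinite ternary word avoiding $f$ has the same set of factors as $b_3$, $\sigma_0(b_3)$ or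 $\sigma_2(b_3)$. 2. The words $b_3$, $\sigma_0(b_3)$ and $\sigma_2(b_3)$ are recurrent and avoid $f$. 3. Every infinite ternary word avoiding $f$ (recurrent or not) has the same set of recurrent factors as $b_3$, $\sigma_0(b_3)$ or $\sigma_2(b_3)$. Thus, up to renaming letters, $b_3$ is essentially the only infinite ternary word avoiding $f$. -/

import Mathlib

/-! Infinite words, avoidance of formulas, and the ternary Thue word `b₃`. -/

/-- An infinite word over the alphabet `α`. -/
abbrev InfWord (α : Type*) := ℕ → α

/-- The factor of length `n` of `w` that starts at position `i`. -/
def InfWord.factorAt {α : Type*} (w : InfWord α) (i n : ℕ) : List α :=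
  List.ofFn (fun k : Fin n => w (i + k))

/-- The finite word `u` appears in `w` at position `i`. -/
def InfWord.OccursAt {α : Type*} (w : InfWord α) (u : List α) (i : ℕ) : Prop :=
  w.factorAt i u.length = u

/-- The set of (finite) factors of `w`. -/
def InfWord.factors {α : Type*} (w : InfWord α) : Set (List α) :=
  {u | ∃ i, w.OccursAt u i}

/-- The set of recurrent factors of `w`: the finite words that appear infinitely many times. -/
def InfWord.recurrentFactors {α : Type*} (w : InfWord α) : Set (List α) :=
  {u | {i | w.OccursAt u i}.Infinite}

/-- A word is recurrent if each of its finite factors appears infinitely many times. -/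
def InfWord.Recurrent {α : Type*} (w : InfWord α) : Prop :=
  ∀ u ∈ w.factors, u ∈ w.recurrentFactors

/-- Two infinite words are equivalent if they have the same set of factors. -/
def InfWord.Equivalent {α : Type*} (v w : InfWord α) : Prop :=
  v.factors = w.factors

/-- The image of the finite word `u` under the morphism of free monoids that sends each letter `a`
to `h a`. -/
def morphImage {α β : Type*} (h : α → List β) (u : List α) : List β :=
  u.flatMap h

/-- A formula over the variables `Δ`, given as the list of its fragments. -/
abbrev Formula (Δ : Type*) := List (List Δ)

/-- The morphism `h` is an occurrence of the formula `f` in `w`: it is non-erasing, and the image of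
every fragment is a factor of `w`. -/
def IsOccurrence {Δ α : Type*} (h : Δ → List α) (f : Formula Δ) (w : InfWord α) : Prop :=
  (∀ X, h X ≠ []) ∧ ∀ p ∈ f, morphImage h p ∈ w.factors

/-- The infinite word `w` avoids the formula `f`. -/
def InfWord.Avoids {Δ α : Type*} (w : InfWord α) (f : Formula Δ) : Prop :=
  ¬ ∃ h : Δ → List α, IsOccurrence h f w

/-- The three variables of ternary formulas. -/
inductive TVar where
  | A
  | B
  | C

/-- `ABCAB.ABCBA.ACB.BAC` -/
def formulaB : Formula TVar :=
  [[.A, .B, .C, .A, .B], [.A, .B, .C, .B, .A], [.A, .C, .B], [.B, .A, .C]]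

/-- `ABCA.BCAB.BCB.CBA` -/
def formula1 : Formula TVar :=
  [[.A, .B, .C, .A], [.B, .C, .A, .B], [.B, .C, .B], [.C, .B, .A]]

/-- `ABCAB.BCB.AC` -/
def formula2 : Formula TVar :=
  [[.A, .B, .C, .A, .B], [.B, .C, .B], [.A, .C]]

/-- `ABCA.BCAB.ACB.BCB` -/
def formula3 : Formula TVar :=
  [[.A, .B, .C, .A], [.B, .C, .A, .B], [.A, .C, .B], [.B, .C, .B]]

/-- `ABCA.BCAB.BCB.AC.BA` -/
def formula4 : Formula TVar :=
  [[.A, .B, .C, .A], [.B, .C, .A, .B], [.B, .C, .B], [.A, .C], [.B, .A]]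

/-- The morphism `0 ↦ 012`, `1 ↦ 02`, `2 ↦ 1`. -/
def thueMorphism : Fin 3 → List (Fin 3) :=
  ![[0, 1, 2], [0, 2], [1]]

/-- The infinite word `w` is a fixed point of the morphism `h`: for every prefix `u` of `w`, the
image of `u` is again a prefix of `w`. For a non-erasing `h` these images exhaust the image of
`w`. -/
def InfWord.IsFixedPoint {α : Type*} (w : InfWord α) (h : α → List α) : Prop :=
  ∀ n, w.OccursAt (morphImage h (w.factorAt 0 n)) 0

/-- The word `b₃`: its letter at position `n` is read off the `n`-th iterate of the morphism at the
letter `0`, which has length greater than `n`. It is shown below to be the only fixed point of the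
morphism. -/
def b3 : InfWord (Fin 3) :=
  fun n => ((morphImage thueMorphism)^[n] [0]).getD n 0

/-- The permutation of the three letters that fixes `c` and exchanges the two others. -/
def sigma (c : Fin 3) : Equiv.Perm (Fin 3) :=
  Equiv.swap (c + 1) (c + 2)

/-- The image of an infinite word under a letter-to-letter morphism. -/
def InfWord.map {α β : Type*} (g : α → β) (w : InfWord α) : InfWord β :=
  fun n => g (w n)

theorem thueMorphism_iterate_prefix (n : ℕ) :
    (morphImage thueMorphism)^[n] [0] <+: (morphImage thueMorphism)^[n + 1] [0] := by
  induction n with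
  | zero => exact ⟨[1, 2], rfl⟩
  | succ n ih =>
    obtain ⟨t, ht⟩ := ih
    refine ⟨morphImage thueMorphism t, ?_⟩
    have h1 := congrArg (morphImage thueMorphism) ht
    rw [Function.iterate_succ_apply' _ (n + 1), ← h1, Function.iterate_succ_apply' _ n]
    simp [morphImage]

theorem thueMorphism_iterate_prefix_of_le {m n : ℕ} (h : m ≤ n) :
    (morphImage thueMorphism)^[m] [0] <+: (morphImage thueMorphism)^[n] [0] := by
  induction n, h using Nat.le_induction with
  | base => exact List.prefix_rfl
  | succ n _ ih => exact ih.trans (thueMorphism_iterate_prefix n)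

theorem morphImage_length_le {α β : Type*} (h : α → List β) (hh : ∀ a, h a ≠ []) (u : List α) :
    u.length ≤ (morphImage h u).length := by
  induction u with
  | nil => simp
  | cons a u ih =>
    have := List.length_pos_of_ne_nil (hh a)
    simp only [morphImage, List.flatMap_cons, List.length_append, List.length_cons] at *
    omega

theorem thueMorphism_ne_nil (a : Fin 3) : thueMorphism a ≠ [] := by
  fin_cases a <;> simp [thueMorphism]

theorem thueMorphism_iterate_length (n : ℕ) :
    n < ((morphImage thueMorphism)^[n] [0]).length := by
  suffices h : ∀ n, ∃ t, (morphImage thueMorphism)^[n] [0] = 0 :: t ∧ n ≤ t.length by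
    obtain ⟨t, ht, hn⟩ := h n
    rw [ht, List.length_cons]; omega
  intro n
  induction n with
  | zero => exact ⟨[], rfl, le_rfl⟩
  | succ n ih =>
    obtain ⟨t, ht, hn⟩ := ih
    refine ⟨[1, 2] ++ morphImage thueMorphism t, ?_, ?_⟩
    · rw [Function.iterate_succ_apply', ht]; rfl
    · have := morphImage_length_le _ thueMorphism_ne_nil t
      simp only [List.length_append, List.length_cons, List.length_nil]; omega

theorem InfWord.occursAt_iff {α : Type*} (w : InfWord α) (u : List α) (i : ℕ) :
    w.OccursAt u i ↔ ∀ k (hk : k < u.length), w (i + k) = u[k] := by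
  unfold InfWord.OccursAt InfWord.factorAt
  constructor
  · intro h k hk
    have := List.getElem_of_eq h (i := k) (by simpa using hk)
    simpa using this
  · intro h
    apply List.ext_getElem
    · simp
    · intro k h1 h2
      simpa using h k h2

theorem b3_occursAt_iterate (m : ℕ) : b3.OccursAt ((morphImage thueMorphism)^[m] [0]) 0 := by
  rw [InfWord.occursAt_iff]
  intro k hk
  have hk' := thueMorphism_iterate_length k
  rw [Nat.zero_add, b3, List.getD_eq_getElem _ _ hk']
  rcases le_total k m with h | h
  · exact (thueMorphism_iterate_prefix_of_le h).getElem hk'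
  · exact ((thueMorphism_iterate_prefix_of_le h).getElem hk).symm

/-- `b₃` is a fixed point of the morphism, and it is the only one. -/
theorem isFixedPoint_thueMorphism_iff (w : InfWord (Fin 3)) :
    w.IsFixedPoint thueMorphism ↔ w = b3 := by
  have pre : ∀ (v : InfWord (Fin 3)) (p q : List (Fin 3)), p <+: q → v.OccursAt q 0 →
      v.OccursAt p 0 := by
    intro v p q hpq hq
    rw [InfWord.occursAt_iff] at hq ⊢
    intro k hk
    rw [hq k (hk.trans_le hpq.length_le), hpq.getElem hk]
  constructor
  · intro h
    have h0 : w 0 = 0 := by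
      have h1 := h 1
      have hf : w.factorAt 0 1 = [w 0] := by simp [InfWord.factorAt]
      rw [InfWord.occursAt_iff, hf] at h1
      generalize hx : w 0 = x at h1
      fin_cases x
      · rfl
      · have := h1 0 (by decide)
        simp [hx, morphImage, thueMorphism] at this
      · have := h1 0 (by decide)
        simp [hx, morphImage, thueMorphism] at this
    have it : ∀ n, w.OccursAt ((morphImage thueMorphism)^[n] [0]) 0 := by
      intro n
      induction n with
      | zero => simp [InfWord.occursAt_iff, h0]
      | succ n ih =>
        rw [Function.iterate_succ_apply']
        have := h ((morphImage thueMorphism)^[n] [0]).length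
        rwa [show w.factorAt 0 _ = _ from ih] at this
    funext n
    have h1 := (w.occursAt_iff _ _).1 (it n) n (thueMorphism_iterate_length n)
    have h2 := (b3.occursAt_iff _ _).1 (b3_occursAt_iterate n) n (thueMorphism_iterate_length n)
    simpa using h1.trans h2.symm
  · rintro rfl n
    refine pre _ _ _ ?_ (b3_occursAt_iterate (n + 1))
    rw [Function.iterate_succ_apply']
    have hp : b3.factorAt 0 n <+: (morphImage thueMorphism)^[n] [0] := by
      have h := b3_occursAt_iterate n
      rw [InfWord.occursAt_iff] at h
      have hl := thueMorphism_iterate_length n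
      rw [List.prefix_iff_eq_take]
      apply List.ext_getElem
      · simp [InfWord.factorAt]; omega
      · intro k h1 h2
        have hk : k < n := by simpa [InfWord.factorAt] using h1
        have := h k (by omega)
        simpa [InfWord.factorAt] using this
    obtain ⟨t, ht⟩ := hp
    exact ⟨morphImage thueMorphism t, by rw [← ht]; simp [morphImage]⟩

/-!
Let `w` avoid `f`. Every fragment of `f` lies inside a fragment of `f_b`, so `w` avoids `f_b`. If
a square `uu` were recurrent in `w`, some factor `uuvuu` would give the occurrence `A, B ↦ u`,
`C ↦ v` of `f_b`; hence the recurrent factors of `w` form a square-free language, and a backtracking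
search shows that it misses one of the pairs `{010, 212}`, `{020, 121}`, `{101, 202}`. Up to some
`σ_c` it is the first one, and then `w` is eventually the word of differences of a binary word. As
overlaps in the latter are squares in `w`, it is eventually overlap-free, so some tail of it is the
image of a word of the same kind under the Thue–Morse morphism. Iterating this, `w` has the
recurrent factors of `b₃`, the word of differences of the Thue–Morse word.

The word `b₃` avoids `f₁`, …, `f₄` by infinite descent. The position of a long factor of the
Thue–Morse word is determined modulo `2`, so an occurrence of a formula with long images comes from
a shorter occurrence of another formula, and short images can be enumerated. Only finitely many
formulas arise. The fragments of `f₂` lie inside those of `f_b`, so `b₃` avoids `f_b` as well.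
-/

open Filter TVar

theorem morphImage_append {α β : Type*} (h : α → List β) (u v : List α) :
    morphImage h (u ++ v) = morphImage h u ++ morphImage h v :=
  List.flatMap_append

namespace InfWord

variable {α β : Type*} {w : InfWord α} {u v : List α} {a : α} {i : ℕ}

theorem factorAt_add (w : InfWord α) (i m n : ℕ) :
    w.factorAt i (m + n) = w.factorAt i m ++ w.factorAt (i + m) n := by
  simp only [factorAt, List.ofFn_add, Fin.val_castLE, Fin.val_natAdd, Nat.add_assoc]

theorem factorAt_one (w : InfWord α) (i : ℕ) : w.factorAt i 1 = [w i] := by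
  simp [factorAt]

theorem length_factorAt (w : InfWord α) (i n : ℕ) : (w.factorAt i n).length = n :=
  List.length_ofFn

theorem occursAt_factorAt (w : InfWord α) (i n : ℕ) : w.OccursAt (w.factorAt i n) i := by
  rw [OccursAt, length_factorAt]

theorem occursAt_nil (w : InfWord α) (i : ℕ) : w.OccursAt [] i := rfl

theorem occursAt_append :
    w.OccursAt (u ++ v) i ↔ w.OccursAt u i ∧ w.OccursAt v (i + u.length) := by
  rw [OccursAt, List.length_append, factorAt_add]
  refine ⟨fun h => List.append_inj h (w.length_factorAt _ _), ?_⟩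
  rintro ⟨hu, hv⟩
  rw [hu, hv]

theorem occursAt_cons : w.OccursAt (a :: u) i ↔ w i = a ∧ w.OccursAt u (i + 1) := by
  rw [← List.singleton_append, occursAt_append, OccursAt, List.length_singleton, factorAt_one,
    List.singleton_inj]

theorem OccursAt.of_infix (h : w.OccursAt v i) (huv : u <:+: v) : ∃ j ≥ i, w.OccursAt u j := by
  obtain ⟨s, t, rfl⟩ := huv
  exact ⟨i + s.length, Nat.le_add_right _ _, (occursAt_append.1 (occursAt_append.1 h).1).2⟩

theorem mem_factors_of_infix (huv : u <:+: v) (hv : v ∈ w.factors) : u ∈ w.factors := by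
  obtain ⟨i, hi⟩ := hv
  obtain ⟨j, -, hj⟩ := hi.of_infix huv
  exact ⟨j, hj⟩

theorem mem_recurrentFactors_iff : u ∈ w.recurrentFactors ↔ ∃ᶠ i in atTop, w.OccursAt u i :=
  Nat.frequently_atTop_iff_infinite.symm

theorem recurrentFactors_subset_factors (w : InfWord α) : w.recurrentFactors ⊆ w.factors :=
  fun _ h => Set.Infinite.nonempty h

theorem Recurrent.recurrentFactors_eq (hw : w.Recurrent) : w.recurrentFactors = w.factors :=
  w.recurrentFactors_subset_factors.antisymm hw

theorem nil_mem_recurrentFactors (w : InfWord α) : [] ∈ w.recurrentFactors :=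
  mem_recurrentFactors_iff.2 (Frequently.of_forall w.occursAt_nil)

theorem mem_recurrentFactors_of_infix (huv : u <:+: v) (hv : v ∈ w.recurrentFactors) :
    u ∈ w.recurrentFactors := by
  rw [mem_recurrentFactors_iff, frequently_atTop] at hv ⊢
  intro N
  obtain ⟨i, hi, h⟩ := hv N
  obtain ⟨j, hj, hu⟩ := h.of_infix huv
  exact ⟨j, hi.trans hj, hu⟩

theorem eventually_not_occursAt (h : u ∉ w.recurrentFactors) : ∀ᶠ i in atTop, ¬ w.OccursAt u i := by
  rwa [mem_recurrentFactors_iff, not_frequently] at h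

theorem eventually_factorAt_mem_recurrentFactors [Finite α] (w : InfWord α) (n : ℕ) :
    ∀ᶠ i in atTop, w.factorAt i n ∈ w.recurrentFactors := by
  have h : ∀ f : Fin n → α, ∀ᶠ i in atTop,
      List.ofFn f ∈ w.recurrentFactors ∨ ¬ w.OccursAt (List.ofFn f) i := by
    intro f
    by_cases hf : List.ofFn f ∈ w.recurrentFactors
    · exact Eventually.of_forall fun _ => Or.inl hf
    · exact (eventually_not_occursAt hf).mono fun _ hi => Or.inr hi
  refine (eventually_all.2 h).mono fun i hi => ?_
  exact (hi fun k => w (i + k)).resolve_right fun hn => hn (w.occursAt_factorAt i n)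

theorem exists_concat_mem_recurrentFactors [Finite α] (hu : u ∈ w.recurrentFactors) :
    ∃ c, u ++ [c] ∈ w.recurrentFactors := by
  obtain ⟨i, hi, h⟩ := ((mem_recurrentFactors_iff.1 hu).and_eventually
    (w.eventually_factorAt_mem_recurrentFactors (u.length + 1))).exists
  rw [factorAt_add, factorAt_one, show w.factorAt i u.length = u from hi] at h
  exact ⟨_, h⟩

theorem exists_cons_mem_recurrentFactors [Finite α] (hu : u ∈ w.recurrentFactors) :
    ∃ c, c :: u ∈ w.recurrentFactors := by
  obtain ⟨N, hN⟩ := eventually_atTop.1 (w.eventually_factorAt_mem_recurrentFactors (1 + u.length))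
  obtain ⟨i, hi, h⟩ := frequently_atTop.1 (mem_recurrentFactors_iff.1 hu) (N + 1)
  obtain ⟨j, rfl⟩ : ∃ j, i = j + 1 := ⟨i - 1, by omega⟩
  have h_mem := hN j (by omega)
  rw [factorAt_add, factorAt_one, show w.factorAt (j + 1) u.length = u from h] at h_mem
  exact ⟨_, h_mem⟩

theorem recurrentFactors_subset_of_eventually_eq {v w : InfWord α} (h : ∀ᶠ i in atTop, v i = w i) :
    v.recurrentFactors ⊆ w.recurrentFactors := by
  intro u hu
  obtain ⟨N, hN⟩ := eventually_atTop.1 h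
  rw [mem_recurrentFactors_iff] at hu ⊢
  refine (hu.and_eventually (eventually_ge_atTop N)).mono fun i ⟨hi, hNi⟩ => ?_
  rw [occursAt_iff] at hi ⊢
  intro k hk
  rw [← hN (i + k) (by omega), hi k hk]

theorem recurrentFactors_congr {v w : InfWord α} (h : ∀ᶠ i in atTop, v i = w i) :
    v.recurrentFactors = w.recurrentFactors :=
  (recurrentFactors_subset_of_eventually_eq h).antisymm
    (recurrentFactors_subset_of_eventually_eq (h.mono fun _ => Eq.symm))

theorem occursAt_map_iff (e : α ≃ β) {w : InfWord α} {u : List β} :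
    (w.map e).OccursAt u i ↔ w.OccursAt (u.map e.symm) i := by
  simp [occursAt_iff, InfWord.map, e.eq_symm_apply]

theorem mem_factors_map (e : α ≃ β) {w : InfWord α} {u : List β} :
    u ∈ (w.map e).factors ↔ u.map e.symm ∈ w.factors := by
  simp_rw [factors, Set.mem_ofPred_eq, occursAt_map_iff]

theorem mem_recurrentFactors_map (e : α ≃ β) {w : InfWord α} {u : List β} :
    u ∈ (w.map e).recurrentFactors ↔ u.map e.symm ∈ w.recurrentFactors := by
  simp_rw [recurrentFactors, Set.mem_ofPred_eq, occursAt_map_iff]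

theorem Recurrent.map {w : InfWord α} (hw : w.Recurrent) (e : α ≃ β) : (w.map e).Recurrent :=
  fun _ hu => (mem_recurrentFactors_map e).2 (hw _ ((mem_factors_map e).1 hu))

variable {Δ : Type*} {f g : Formula Δ}

theorem Avoids.of_forall_exists_infix (hf : w.Avoids f) (h : ∀ p ∈ f, ∃ q ∈ g, p <:+: q) :
    w.Avoids g := by
  rintro ⟨m, hm, hg⟩
  refine hf ⟨m, hm, fun p hp => ?_⟩
  obtain ⟨q, hq, s, t, rfl⟩ := h p hp
  refine mem_factors_of_infix ⟨morphImage m s, morphImage m t, ?_⟩ (hg _ hq)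
  rw [morphImage_append, morphImage_append]

theorem Avoids.map {w : InfWord α} (hw : w.Avoids f) (e : α ≃ β) : (w.map e).Avoids f := by
  rintro ⟨h, h_ne, h_mem⟩
  refine hw ⟨fun X => (h X).map e.symm, fun X => by simpa using h_ne X, fun p hp => ?_⟩
  have h_image := (mem_factors_map e).1 (h_mem p hp)
  rwa [morphImage, List.map_flatMap] at h_image

end InfWord

/-- A nonempty set of words closed under factors, in which every word extends on both sides, and
which contains no square. The recurrent factors of a square-free infinite word form one. -/
structure SquareFreeLanguage {α : Type*} (R : Set (List α)) : Prop where
  nil_mem : [] ∈ R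
  of_infix : ∀ {u v : List α}, u <:+: v → v ∈ R → u ∈ R
  exists_concat : ∀ {u}, u ∈ R → ∃ c, u ++ [c] ∈ R
  exists_cons : ∀ {u}, u ∈ R → ∃ c, c :: u ∈ R
  eq_nil_of_square : ∀ {u}, u ++ u ∈ R → u = []

theorem SquareFreeLanguage.reverse {α : Type*} {R : Set (List α)} (hR : SquareFreeLanguage R) :
    SquareFreeLanguage {u | u.reverse ∈ R} where
  nil_mem := hR.nil_mem
  of_infix h hv := hR.of_infix (List.reverse_infix.2 h) hv
  exists_concat {u} h := by
    obtain ⟨c, hc⟩ := hR.exists_cons h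
    exact ⟨c, by simpa using hc⟩
  exists_cons {u} h := by
    obtain ⟨c, hc⟩ := hR.exists_concat h
    exact ⟨c, by simpa using hc⟩
  eq_nil_of_square {u} h := by
    simpa using hR.eq_nil_of_square (u := u.reverse) (by simpa using h)

/-- Test whether `u ++ t` has a square prefix `v ++ v` such that `v` is a proper extension of
`u`. -/
def hasSquarePrefixFrom {α : Type*} [BEq α] (u : List α) : List α → Bool
  | [] => false
  | a :: t => (u ++ [a]).isPrefixOf t || hasSquarePrefixFrom (u ++ [a]) t

theorem exists_square_of_hasSquarePrefixFrom {α : Type*} [BEq α] [LawfulBEq α] {u t : List α}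
    (h : hasSquarePrefixFrom u t = true) : ∃ v ≠ [], v ++ v <+: u ++ t := by
  induction t generalizing u with
  | nil => simp [hasSquarePrefixFrom] at h
  | cons a t ih =>
    rw [List.append_cons]
    rcases Bool.or_eq_true_iff.1 h with h | h
    · exact ⟨u ++ [a], by simp, (List.prefix_append_right_inj _).2 (List.isPrefixOf_iff_prefix.1 h)⟩
    · exact ih h

/-- Backtracking search, extending alternately to both sides, for square-free extensions of the
word in the last argument with no factor in the first list; the second list consists of the
reversals of the first one. The value `true` means that the search dies out within the given number
of steps. -/
def diesWithin : ℕ → List (List (Fin 3)) → List (List (Fin 3)) → List (Fin 3) → Bool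
  | 0, _, _, _ => false
  | n + 1, F, F', w => [0, 1, 2].all fun c =>
      F.any (·.isPrefixOf (c :: w)) || hasSquarePrefixFrom [] (c :: w) ||
        diesWithin n F' F (c :: w).reverse

/-- The word `w` has only finitely many square-free extensions that avoid the factors in `F`. The
bound `100` on the length of the extensions exceeds what is needed below. -/
def IsDead (F : List (List (Fin 3))) (w : List (Fin 3)) : Prop :=
  diesWithin 100 F (F.map List.reverse) w = true

instance (F : List (List (Fin 3))) (w : List (Fin 3)) : Decidable (IsDead F w) :=
  inferInstanceAs (Decidable (_ = _))

namespace SquareFreeLanguage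

variable {R : Set (List (Fin 3))} {F : List (List (Fin 3))} {w : List (Fin 3)}

theorem not_mem_of_diesWithin {n : ℕ} {F' : List (List (Fin 3))} (hR : SquareFreeLanguage R)
    (hF : ∀ b ∈ F, b ∉ R) (hF' : ∀ b ∈ F', b.reverse ∉ R) (h : diesWithin n F F' w = true) :
    w ∉ R := by
  induction n generalizing R F F' w with
  | zero => simp [diesWithin] at h
  | succ n ih =>
    intro hw
    obtain ⟨c, hc⟩ := hR.exists_cons hw
    have h_step := List.all_eq_true.1 h c (by fin_cases c <;> simp)
    rw [Bool.or_eq_true, Bool.or_eq_true] at h_step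
    rcases h_step with (h_ban | h_square) | h_rec
    · obtain ⟨b, hb, hbc⟩ := List.any_eq_true.1 h_ban
      exact hF b hb (hR.of_infix (List.isPrefixOf_iff_prefix.1 hbc).isInfix hc)
    · obtain ⟨v, hv, hvc⟩ := exists_square_of_hasSquarePrefixFrom h_square
      exact hv (hR.eq_nil_of_square (hR.of_infix hvc.isInfix hc))
    · exact ih hR.reverse hF' (by simpa using hF) h_rec (by simpa using hc)

theorem not_mem_of_isDead (hR : SquareFreeLanguage R) (hF : ∀ b ∈ F, b ∉ R) (h : IsDead F w) :
    w ∉ R :=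
  hR.not_mem_of_diesWithin hF (List.forall_mem_map.2 (by simpa using hF)) h

theorem mem_of_isDead_cons (hR : SquareFreeLanguage R) {b : List (Fin 3)} (h : IsDead (b :: F) w)
    (hF : ∀ b ∈ F, b ∉ R) (hw : w ∈ R) : b ∈ R := by
  by_contra hb
  exact hR.not_mem_of_isDead (List.forall_mem_cons.2 ⟨hb, hF⟩) h hw

end SquareFreeLanguage

/-- The ordered pairs of distinct letters. A pair `(b, c)` stands for the renaming `(a, b, c)` of
the three letters, where `a` is its `thirdLetter`. -/
def letterPairs : List (Fin 3 × Fin 3) := [(0, 1), (0, 2), (1, 0), (1, 2), (2, 0), (2, 1)]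

/-- The letter that does not occur in a pair of distinct letters (which add up to `0` with it). -/
def thirdLetter (p : Fin 3 × Fin 3) : Fin 3 := -(p.1 + p.2)

/-- The letter-to-letter morphism `A ↦ a`, `B ↦ b`, `C ↦ c` of the pair `(b, c)`. -/
def letterMorphism (p : Fin 3 × Fin 3) : TVar → List (Fin 3)
  | A => [thirdLetter p]
  | B => [p.1]
  | C => [p.2]

/-- The morphism `A ↦ bc`, `B ↦ a`, `C ↦ bac` of the pair `(b, c)`. -/
def longMorphism (p : Fin 3 × Fin 3) : TVar → List (Fin 3)
  | A => [p.1, p.2]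
  | B => [thirdLetter p]
  | C => [p.1, thirdLetter p, p.2]

/-- The image of `BCB` under `letterMorphism`. This and the following images are spelled out to
speed up their evaluation in the kernel. -/
def wordBCB (p : Fin 3 × Fin 3) : List (Fin 3) :=
  [p.1, p.2, p.1]

/-- The image of `ABCAB` under `letterMorphism`. -/
def wordABCAB (p : Fin 3 × Fin 3) : List (Fin 3) :=
  [thirdLetter p, p.1, p.2, thirdLetter p, p.1]

/-- The image of `ABCAB` under `longMorphism`. -/
def longABCAB (p : Fin 3 × Fin 3) : List (Fin 3) :=
  [p.1, p.2, thirdLetter p, p.1, thirdLetter p, p.2, p.1, p.2, thirdLetter p]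

/-- The image of `ABCBA` under `longMorphism`. -/
def longABCBA (p : Fin 3 × Fin 3) : List (Fin 3) :=
  [p.1, p.2, thirdLetter p, p.1, thirdLetter p, p.2, thirdLetter p, p.1, p.2]

/-- The image of `ACB` under `longMorphism`. -/
def longACB (p : Fin 3 × Fin 3) : List (Fin 3) :=
  [p.1, p.2, p.1, thirdLetter p, p.2, thirdLetter p]

/-- The image of `BAC` under `longMorphism`. -/
def longBAC (p : Fin 3 × Fin 3) : List (Fin 3) :=
  [thirdLetter p, p.1, p.2, p.1, thirdLetter p, p.2]

/-- For each pair of distinct letters one forbidden word: `f p` for `p ∈ S`, and `g p`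
otherwise. -/
def forbiddenBy (S : List (Fin 3 × Fin 3)) (f g : Fin 3 × Fin 3 → List (Fin 3)) :
    List (List (Fin 3)) :=
  letterPairs.map fun p => if p ∈ S then f p else g p

/-- The words `wordBCB p` for `p ∈ S` meet each of `{010, 212}`, `{020, 121}`, `{101, 202}`. -/
def MeetsAllPairs (S : List (Fin 3 × Fin 3)) : Prop :=
  ((0, 1) ∈ S ∨ (2, 1) ∈ S) ∧ ((0, 2) ∈ S ∨ (1, 2) ∈ S) ∧ ((1, 0) ∈ S ∨ (2, 0) ∈ S)

instance (S : List (Fin 3 × Fin 3)) : Decidable (MeetsAllPairs S) :=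
  inferInstanceAs (Decidable (_ ∧ _))

theorem isDead_letter : ∀ c : Fin 3, IsDead [[c]] [] := by
  decide +kernel

theorem isDead_permutation : ∀ a b c : Fin 3, [a, b, c].Nodup → IsDead [[a, b, c]] [a] := by
  decide +kernel

theorem isDead_cons_wordBCB_concat :
    ∀ p ∈ letterPairs, IsDead [thirdLetter p :: wordBCB p ++ [thirdLetter p]] (wordBCB p) := by
  decide +kernel

theorem isDead_of_meetsAllPairs : ∀ S ∈ letterPairs.sublists, MeetsAllPairs S → S ≠ letterPairs →
    ∃ p ∈ S, IsDead (forbiddenBy S wordABCAB wordBCB) (wordBCB p) := by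
  decide +kernel

theorem isDead_longACB :
    ∀ p ∈ letterPairs, IsDead (longACB p :: letterPairs.map wordABCAB) (wordBCB p) := by
  decide +kernel

theorem isDead_longBAC :
    ∀ p ∈ letterPairs, IsDead (longBAC p :: letterPairs.map wordABCAB) (wordBCB p) := by
  decide +kernel

theorem isDead_longABCAB : ∀ S ∈ letterPairs.sublists, ∀ p ∈ S,
    IsDead (forbiddenBy S longABCBA longABCAB ++ letterPairs.map wordABCAB) (longABCAB p) := by
  decide +kernel

theorem isDead_forall_longABCAB :
    IsDead (letterPairs.map longABCAB ++ letterPairs.map wordABCAB) (wordBCB (0, 1)) := by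
  decide +kernel

/-- A square-free language that contains no occurrence of the formula `f_b`. -/
structure FormulaBFreeLanguage (R : Set (List (Fin 3))) : Prop extends SquareFreeLanguage R where
  exists_not_mem : ∀ h : TVar → List (Fin 3), (∀ X, h X ≠ []) → ∃ u ∈ formulaB, morphImage h u ∉ R

namespace FormulaBFreeLanguage

variable {R : Set (List (Fin 3))} {p : Fin 3 × Fin 3}

theorem letter_mem (hR : FormulaBFreeLanguage R) (c : Fin 3) : [c] ∈ R :=
  hR.mem_of_isDead_cons (isDead_letter c) (by simp) hR.nil_mem

theorem permutation_mem (hR : FormulaBFreeLanguage R) {a b c : Fin 3} (h : [a, b, c].Nodup) :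
    [a, b, c] ∈ R :=
  hR.mem_of_isDead_cons (isDead_permutation a b c h) (by simp) (hR.letter_mem a)

theorem not_mem_forbiddenBy {S : List (Fin 3 × Fin 3)} {f g : Fin 3 × Fin 3 → List (Fin 3)}
    (hf : ∀ p ∈ letterPairs, p ∈ S → f p ∉ R) (hg : ∀ p ∈ letterPairs, p ∉ S → g p ∉ R) :
    ∀ b ∈ forbiddenBy S f g, b ∉ R := by
  refine List.forall_mem_map.2 fun p hp => ?_
  split_ifs with h
  exacts [hf p hp h, hg p hp h]

theorem wordABCAB_not_mem (hR : FormulaBFreeLanguage R) (hp : p ∈ letterPairs)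
    (h : wordBCB p ∈ R) : wordABCAB p ∉ R := by
  have h_nodup : ∀ p ∈ letterPairs,
      [thirdLetter p, p.2, p.1].Nodup ∧ [p.1, thirdLetter p, p.2].Nodup := by decide
  have h_ABCBA : thirdLetter p :: wordBCB p ++ [thirdLetter p] ∈ R :=
    hR.mem_of_isDead_cons (isDead_cons_wordBCB_concat p hp) (by simp) h
  have h_ACB := hR.permutation_mem (h_nodup p hp).1
  have h_BAC := hR.permutation_mem (h_nodup p hp).2
  obtain ⟨u, hu, huR⟩ := hR.exists_not_mem (letterMorphism p)
    (by rintro ⟨⟩ <;> simp [letterMorphism])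
  simp only [formulaB, List.mem_cons, List.not_mem_nil, or_false] at hu
  rcases hu with rfl | rfl | rfl | rfl
  exacts [huR, absurd h_ABCBA huR, absurd h_ACB huR, absurd h_BAC huR]

open Classical in
theorem wordBCB_mem_of_meetsAllPairs (hR : FormulaBFreeLanguage R)
    (h : MeetsAllPairs (letterPairs.filter (wordBCB · ∈ R))) :
    ∀ p ∈ letterPairs, wordBCB p ∈ R := by
  by_contra! h_missing
  have h_ne : letterPairs.filter (wordBCB · ∈ R) ≠ letterPairs := by
    simpa [List.filter_eq_self] using h_missing
  obtain ⟨p, hp, h_dead⟩ :=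
    isDead_of_meetsAllPairs _ (List.mem_sublists.2 List.filter_sublist) h h_ne
  refine hR.not_mem_of_isDead (not_mem_forbiddenBy (fun q hq hqS => ?_) fun q hq hqS => ?_) h_dead
    (by simpa using (List.mem_filter.1 hp).2)
  · exact hR.wordABCAB_not_mem hq (by simpa [hq] using hqS)
  · simpa [hq] using hqS

theorem forall_wordABCAB_not_mem (hR : FormulaBFreeLanguage R)
    (hR' : ∀ p ∈ letterPairs, wordBCB p ∈ R) : ∀ b ∈ letterPairs.map wordABCAB, b ∉ R :=
  List.forall_mem_map.2 fun p hp => hR.wordABCAB_not_mem hp (hR' p hp)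

theorem longABCBA_not_mem (hR : FormulaBFreeLanguage R) (hR' : ∀ p ∈ letterPairs, wordBCB p ∈ R)
    (hp : p ∈ letterPairs) (h : longABCAB p ∈ R) : longABCBA p ∉ R := by
  have h_ACB : longACB p ∈ R :=
    hR.mem_of_isDead_cons (isDead_longACB p hp) (hR.forall_wordABCAB_not_mem hR') (hR' p hp)
  have h_BAC : longBAC p ∈ R :=
    hR.mem_of_isDead_cons (isDead_longBAC p hp) (hR.forall_wordABCAB_not_mem hR') (hR' p hp)
  obtain ⟨u, hu, huR⟩ := hR.exists_not_mem (longMorphism p) (by rintro ⟨⟩ <;> simp [longMorphism])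
  simp only [formulaB, List.mem_cons, List.not_mem_nil, or_false] at hu
  rcases hu with rfl | rfl | rfl | rfl
  exacts [absurd h huR, huR, absurd h_ACB huR, absurd h_BAC huR]

open Classical in
theorem longABCAB_not_mem (hR : FormulaBFreeLanguage R) (hR' : ∀ p ∈ letterPairs, wordBCB p ∈ R)
    (hp : p ∈ letterPairs) : longABCAB p ∉ R := by
  intro h
  have hpS : p ∈ letterPairs.filter (longABCAB · ∈ R) := by simp [hp, h]
  have h_dead := isDead_longABCAB _ (List.mem_sublists.2 List.filter_sublist) p hpS
  refine hR.not_mem_of_isDead (List.forall_mem_append.2 ⟨not_mem_forbiddenBy (fun q hq hqS => ?_)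
    fun q hq hqS => ?_, hR.forall_wordABCAB_not_mem hR'⟩) h_dead h
  · exact hR.longABCBA_not_mem hR' hq (by simpa [hq] using hqS)
  · simpa [hq] using hqS

theorem false_of_forall_wordBCB_mem (hR : FormulaBFreeLanguage R)
    (hR' : ∀ p ∈ letterPairs, wordBCB p ∈ R) : False :=
  hR.not_mem_of_isDead
    (List.forall_mem_append.2 ⟨List.forall_mem_map.2 fun _ hp => hR.longABCAB_not_mem hR' hp,
      hR.forall_wordABCAB_not_mem hR'⟩)
    isDead_forall_longABCAB (hR' (0, 1) (by decide))

theorem exists_avoided_pair (hR : FormulaBFreeLanguage R) :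
    ([0, 1, 0] ∉ R ∧ [2, 1, 2] ∉ R) ∨ ([0, 2, 0] ∉ R ∧ [1, 2, 1] ∉ R) ∨
      ([1, 0, 1] ∉ R ∧ [2, 0, 2] ∉ R) := by
  classical
  by_contra h
  refine hR.false_of_forall_wordBCB_mem (hR.wordBCB_mem_of_meetsAllPairs ?_)
  have h_mem : ∀ p ∈ letterPairs, (p ∈ letterPairs.filter (wordBCB · ∈ R) ↔ wordBCB p ∈ R) := by
    simp +contextual
  simp only [letterPairs, List.forall_mem_cons] at h_mem
  simp only [MeetsAllPairs]
  tauto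

end FormulaBFreeLanguage

theorem InfWord.exists_append_mem_factors {α : Type*} {w : InfWord α} {u : List α}
    (hu : u ∈ w.recurrentFactors) : ∃ v ≠ [], u ++ v ++ u ∈ w.factors := by
  obtain ⟨i, hi⟩ := w.recurrentFactors_subset_factors hu
  obtain ⟨j, hj, hju⟩ := frequently_atTop.1 (mem_recurrentFactors_iff.1 hu) (i + u.length + 1)
  obtain ⟨n, rfl⟩ := Nat.exists_eq_add_of_le hj
  have h_len := w.length_factorAt (i + u.length) (n + 1)
  refine ⟨w.factorAt (i + u.length) (n + 1), List.ne_nil_of_length_eq_add_one h_len, i, ?_⟩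
  rw [occursAt_append, occursAt_append, List.length_append, h_len]
  refine ⟨⟨hi, w.occursAt_factorAt _ _⟩, ?_⟩
  convert hju using 1
  ring

theorem eq_nil_of_append_self_mem_recurrentFactors {w : InfWord (Fin 3)} (hw : w.Avoids formulaB)
    {u : List (Fin 3)} (hu : u ++ u ∈ w.recurrentFactors) : u = [] := by
  by_contra hu_ne
  obtain ⟨v, hv_ne, huv⟩ := InfWord.exists_append_mem_factors hu
  refine hw ⟨fun | A => u | B => u | C => v, ?_, fun p hp => ?_⟩
  · rintro ⟨⟩ <;> assumption
  · refine InfWord.mem_factors_of_infix ?_ huv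
    simp only [formulaB, List.mem_cons, List.not_mem_nil, or_false] at hp
    rcases hp with rfl | rfl | rfl | rfl
    exacts [⟨[], [], by simp [morphImage]⟩, ⟨[], [], by simp [morphImage]⟩,
      ⟨u, u, by simp [morphImage]⟩, ⟨[], u ++ u, by simp [morphImage]⟩]

theorem formulaBFreeLanguage_recurrentFactors {w : InfWord (Fin 3)} (hw : w.Avoids formulaB) :
    FormulaBFreeLanguage w.recurrentFactors where
  nil_mem := w.nil_mem_recurrentFactors
  of_infix := InfWord.mem_recurrentFactors_of_infix
  exists_concat := InfWord.exists_concat_mem_recurrentFactors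
  exists_cons := InfWord.exists_cons_mem_recurrentFactors
  eq_nil_of_square := eq_nil_of_append_self_mem_recurrentFactors hw
  exists_not_mem h h_ne := by
    by_contra! h_mem
    exact hw ⟨h, h_ne, fun p hp => w.recurrentFactors_subset_factors (h_mem p hp)⟩

/-- The Thue–Morse word: the parity of the number of binary digits `1`. -/
def thueMorse : InfWord Bool :=
  fun n => n.bits.foldr xor false

theorem thueMorse_bit (b : Bool) (n : ℕ) : thueMorse (Nat.bit b n) = xor b (thueMorse n) := by
  by_cases h : n = 0 → b = true
  · rw [thueMorse, Nat.bits_append_bit n b h, List.foldr_cons, thueMorse]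
  · push Not at h
    obtain ⟨rfl, hb⟩ := h
    rw [Bool.eq_false_iff.2 hb]
    rfl

theorem thueMorse_two_mul (n : ℕ) : thueMorse (2 * n) = thueMorse n := by
  simpa [Nat.bit_false] using thueMorse_bit false n

theorem thueMorse_two_mul_add_one (n : ℕ) : thueMorse (2 * n + 1) = !thueMorse n := by
  simpa [Nat.bit_true] using thueMorse_bit true n

/-- The letter that codes two consecutive bits by their difference. -/
def diffLetter : Bool → Bool → Fin 3
  | false, true => 0
  | true, false => 2
  | _, _ => 1

/-- The ternary word of the differences of a binary word. -/
def diffWord (s : InfWord Bool) : InfWord (Fin 3) :=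
  fun n => diffLetter (s n) (s (n + 1))

theorem diffWord_occursAt_iff {s : InfWord Bool} {u : List (Fin 3)} {i : ℕ} :
    (diffWord s).OccursAt u i ↔
      ∀ k (hk : k < u.length), diffLetter (s (i + k)) (s (i + (k + 1))) = u[k] :=
  InfWord.occursAt_iff _ _ _

theorem InfWord.OccursAt.diffWord_congr {s t : InfWord Bool} {u : List (Fin 3)} {i j : ℕ}
    (hu : (diffWord s).OccursAt u i) (h : ∀ k ≤ u.length, s (i + k) = t (j + k)) :
    (diffWord t).OccursAt u j := by
  rw [diffWord_occursAt_iff] at hu ⊢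
  intro k hk
  rw [← h k hk.le, ← h (k + 1) hk, hu k hk]

theorem length_thueMorphism_diffLetter_add : ∀ x y : Bool,
    (thueMorphism (diffLetter x y)).length + x.toNat = 2 + y.toNat := by
  decide

theorem diffWord_thueMorse_occursAt_thueMorphism (n : ℕ) :
    (diffWord thueMorse).OccursAt (thueMorphism (diffWord thueMorse n))
      (2 * n + (thueMorse n).toNat) := by
  have h_even := thueMorse_two_mul n
  have h_odd := thueMorse_two_mul_add_one n
  have h_even' : thueMorse (2 * n + 1 + 1) = thueMorse (n + 1) := thueMorse_two_mul (n + 1)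
  have h_odd' : thueMorse (2 * n + 1 + 1 + 1) = !thueMorse (n + 1) :=
    thueMorse_two_mul_add_one (n + 1)
  cases hx : thueMorse n <;> cases hy : thueMorse (n + 1) <;>
    simp [diffWord, diffLetter, thueMorphism, InfWord.occursAt_cons, InfWord.occursAt_nil, *]

theorem diffWord_thueMorse : diffWord thueMorse = b3 := by
  rw [← isFixedPoint_thueMorphism_iff]
  set w := diffWord thueMorse
  have h_image : ∀ n, (morphImage thueMorphism (w.factorAt 0 n)).length =
      2 * n + (thueMorse n).toNat ∧ w.OccursAt (morphImage thueMorphism (w.factorAt 0 n)) 0 := by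
    intro n
    induction n with
    | zero => exact ⟨rfl, rfl⟩
    | succ n ih =>
      have h_letter : morphImage thueMorphism [w n] = thueMorphism (w n) :=
        List.flatMap_singleton _ _
      have h_length := length_thueMorphism_diffLetter_add (thueMorse n) (thueMorse (n + 1))
      have h_occursAt := diffWord_thueMorse_occursAt_thueMorphism n
      rw [InfWord.factorAt_add, InfWord.factorAt_one, Nat.zero_add, morphImage_append,
        List.length_append, InfWord.occursAt_append, ih.1, h_letter, Nat.zero_add]
      refine ⟨?_, ih.2, h_occursAt⟩
      change _ + (thueMorphism (diffLetter _ _)).length = _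
      omega
  exact fun n => (h_image n).2

/-- From position `p` on, `s` is the image of `s'` under the `k`-th power of the Thue–Morse morphism
`0 ↦ 01`, `1 ↦ 10`. -/
def IsThueMorseImageFrom (k p : ℕ) (s s' : InfWord Bool) : Prop :=
  ∀ n, ∀ r < 2 ^ k, s (p + (2 ^ k * n + r)) = xor (s' n) (thueMorse r)

namespace IsThueMorseImageFrom

variable {k p q m n : ℕ} {s s' t t' : InfWord Bool}

theorem refl (s : InfWord Bool) : IsThueMorseImageFrom 0 0 s s := by
  intro n r hr
  obtain rfl : r = 0 := by simpa using hr
  rw [pow_zero, one_mul, Nat.zero_add, Nat.add_zero]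
  exact (Bool.xor_false _).symm

theorem one_iff : IsThueMorseImageFrom 1 p s s' ↔
    ∀ n, s (p + 2 * n) = s' n ∧ s (p + (2 * n + 1)) = !s' n := by
  refine forall_congr' fun n => ⟨fun h => ⟨?_, ?_⟩, fun h r hr => ?_⟩
  · simpa [thueMorse] using h 0 (by decide)
  · simpa [thueMorse] using h 1 (by decide)
  · interval_cases r
    · simpa [thueMorse] using h.1
    · simpa [thueMorse] using h.2

theorem comp (hs : IsThueMorseImageFrom 1 q s t) (ht : IsThueMorseImageFrom k p t t') :
    IsThueMorseImageFrom (k + 1) (q + 2 * p) s t' := by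
  rw [one_iff] at hs
  intro n r hr
  obtain ⟨j, rfl | rfl⟩ := Nat.even_or_odd' r
  · rw [show q + 2 * p + (2 ^ (k + 1) * n + 2 * j) = q + 2 * (p + (2 ^ k * n + j)) by ring,
      (hs _).1, ht n j (by omega), thueMorse_two_mul]
  · rw [show q + 2 * p + (2 ^ (k + 1) * n + (2 * j + 1)) = q + (2 * (p + (2 ^ k * n + j)) + 1) by
        ring, (hs _).2, ht n j (by omega), thueMorse_two_mul_add_one, Bool.xor_not]

theorem thueMorse (k : ℕ) : IsThueMorseImageFrom k 0 thueMorse thueMorse := by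
  induction k with
  | zero => exact refl _
  | succ k ih =>
    refine comp (one_iff.2 fun n => ?_) ih
    rw [Nat.zero_add, Nat.zero_add]
    exact ⟨thueMorse_two_mul n, thueMorse_two_mul_add_one n⟩

theorem eq_of_eq (hs : IsThueMorseImageFrom k p s s') (ht : IsThueMorseImageFrom k q t t')
    (h : s' n = t' m) {r : ℕ} (hr : r < 2 ^ k) :
    s (p + (2 ^ k * n + r)) = t (q + (2 ^ k * m + r)) := by
  rw [hs n r hr, ht m r hr, h]

theorem eq_of_eq_of_succ_eq (hs : IsThueMorseImageFrom k p s s')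
    (ht : IsThueMorseImageFrom k q t t') (h : s' n = t' m) (h_succ : s' (n + 1) = t' (m + 1))
    {r : ℕ} (hr : r < 2 ^ k + 2 ^ k) : s (p + (2 ^ k * n + r)) = t (q + (2 ^ k * m + r)) := by
  rcases lt_or_ge r (2 ^ k) with hr_lt | hr_le
  · exact hs.eq_of_eq ht h hr_lt
  · obtain ⟨r, rfl⟩ := Nat.exists_eq_add_of_le hr_le
    convert hs.eq_of_eq ht h_succ (Nat.lt_of_add_lt_add_left hr) using 2 <;> ring

end IsThueMorseImageFrom

/-- An overlap of period `p` at position `i`: a factor `x ++ x ++ [a]` where `x` has length `p` and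
first letter `a`. -/
def OverlapAt (s : InfWord Bool) (p i : ℕ) : Prop :=
  ∀ k ≤ p, s (i + k) = s (i + p + k)

/-- For each period, the overlaps with this period appear only finitely many times. -/
def EventuallyOverlapFree (s : InfWord Bool) : Prop :=
  ∀ p > 0, ∀ᶠ i in atTop, ¬ OverlapAt s p i

theorem overlapAt_one_of_eq {s : InfWord Bool} {i : ℕ} (h₀ : s i = s (i + 1))
    (h₁ : s (i + 1) = s (i + 2)) : OverlapAt s 1 i := by
  intro k hk
  interval_cases k
  exacts [h₀, h₁]

theorem overlapAt_two_of_ne {s : InfWord Bool} {i : ℕ} (h₀ : s i ≠ s (i + 1))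
    (h₁ : s (i + 1) ≠ s (i + 2)) (h₂ : s (i + 2) ≠ s (i + 3)) (h₃ : s (i + 3) ≠ s (i + 4)) :
    OverlapAt s 2 i := by
  have h_eq : ∀ {a b c : Bool}, a ≠ b → b ≠ c → a = c := by decide
  intro k hk
  interval_cases k
  exacts [h_eq h₀ h₁, h_eq h₁ h₂, h_eq h₂ h₃]

theorem overlapAt_three_of_eq {s : InfWord Bool} {i : ℕ} (h₀ : s i ≠ s (i + 1))
    (h₁ : s (i + 1) = s (i + 2)) (h₂ : s (i + 2) ≠ s (i + 3)) (h₃ : s (i + 3) ≠ s (i + 4))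
    (h₄ : s (i + 4) = s (i + 5)) (h₅ : s (i + 5) ≠ s (i + 6)) : OverlapAt s 3 i := by
  have h_eq : ∀ {a b c d : Bool}, a ≠ b → b = c → c ≠ d → a = d := by decide
  have h_eq' : ∀ {a b c : Bool}, a ≠ b → b ≠ c → a = c := by decide
  intro k hk
  interval_cases k
  exacts [h_eq h₀ h₁ h₂, h₁.trans (h_eq' h₂ h₃), (h_eq' h₂ h₃).trans h₄, h_eq h₃ h₄ h₅]

theorem not_add_odd_of_gaps {P : ℕ → Prop} (h₁ : ∀ i, P i → ¬ P (i + 1))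
    (h₃ : ∀ i, P (i + 1) → ¬ P (i + 4)) (h₄ : ∀ i, P i ∨ P (i + 1) ∨ P (i + 2) ∨ P (i + 3))
    {i : ℕ} (hi : P (i + 1)) (n : ℕ) : ¬ P (i + 1 + (2 * n + 1)) := by
  induction n using Nat.strong_induction_on generalizing i with
  | _ n ih =>
    match n, ih with
    | 0, _ => exact h₁ _ hi
    | 1, _ => exact h₃ _ hi
    | n + 2, ih =>
      rcases h₄ (i + 2) with h | h | h | h
      · exact absurd h (h₁ _ hi)
      · convert ih (n + 1) (by omega) h using 2
        ring
      · exact absurd h (h₃ _ hi)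
      · convert ih n (by omega) h using 2
        ring

theorem exists_forall_ne_of_not_overlapAt {s : InfWord Bool}
    (hs : ∀ p ∈ Finset.Icc 1 3, ∀ i, ¬ OverlapAt s p i) :
    ∃ p, ∀ n, s (p + 2 * n) ≠ s (p + (2 * n + 1)) := by
  have h₁ : ∀ i, s i = s (i + 1) → ¬ s (i + 1) = s (i + 2) := fun i h h' =>
    hs 1 (by decide) i (overlapAt_one_of_eq h h')
  have h₄ : ∀ i, s i = s (i + 1) ∨ s (i + 1) = s (i + 2) ∨ s (i + 2) = s (i + 3) ∨
      s (i + 3) = s (i + 4) := by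
    intro i
    by_contra! h
    exact hs 2 (by decide) i (overlapAt_two_of_ne h.1 h.2.1 h.2.2.1 h.2.2.2)
  have h₃ : ∀ i, s (i + 1) = s (i + 2) → ¬ s (i + 4) = s (i + 5) := fun i h h' =>
    hs 3 (by decide) i <| overlapAt_three_of_eq (fun h₀ => h₁ i h₀ h) h (h₁ _ h)
      (fun h₃ => h₁ _ h₃ h') h' (h₁ _ h')
  obtain ⟨i, hi⟩ : ∃ i, s (i + 1) = s (i + 2) := by
    rcases h₄ 1 with h | h | h | h <;> exact ⟨_, h⟩
  exact ⟨i + 2, fun n h => not_add_odd_of_gaps (P := fun i => s i = s (i + 1)) h₁ h₃ h₄ hi n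
    (by convert h using 2 <;> ring)⟩

namespace EventuallyOverlapFree

variable {s : InfWord Bool}

theorem exists_forall_ne (hs : EventuallyOverlapFree s) :
    ∃ p, ∀ n, s (p + 2 * n) ≠ s (p + (2 * n + 1)) := by
  have h_small : ∀ᶠ i in atTop, ∀ p ∈ Finset.Icc 1 3, ¬ OverlapAt s p i :=
    (eventually_all_finset _).2 fun p hp => hs p (Finset.mem_Icc.1 hp).1
  obtain ⟨N, hN⟩ := eventually_atTop.1 h_small
  obtain ⟨p, hp⟩ := exists_forall_ne_of_not_overlapAt (s := fun n => s (N + n)) fun p hp i h =>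
    hN (N + i) (Nat.le_add_right N i) p hp fun k hk => by
      simpa only [Nat.add_assoc] using h k hk
  exact ⟨N + p, fun n => by simpa only [Nat.add_assoc] using hp n⟩

theorem desubstitute {s' : InfWord Bool} {p : ℕ} (hs : EventuallyOverlapFree s)
    (h : IsThueMorseImageFrom 1 p s s') : EventuallyOverlapFree s' := by
  rw [IsThueMorseImageFrom.one_iff] at h
  intro q hq
  obtain ⟨N, hN⟩ := eventually_atTop.1 (hs (2 * q) (by omega))
  refine eventually_atTop.2 ⟨N, fun i hi h_overlap => hN (p + 2 * i) (by omega) fun k hk => ?_⟩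
  obtain ⟨j, rfl | rfl⟩ := Nat.even_or_odd' k
  · rw [show p + 2 * i + 2 * j = p + 2 * (i + j) by ring,
      show p + 2 * i + 2 * q + 2 * j = p + 2 * (i + q + j) by ring, (h _).1, (h _).1,
      h_overlap j (by omega)]
  · rw [show p + 2 * i + (2 * j + 1) = p + (2 * (i + j) + 1) by ring,
      show p + 2 * i + 2 * q + (2 * j + 1) = p + (2 * (i + q + j) + 1) by ring, (h _).2, (h _).2,
      h_overlap j (by omega)]

theorem exists_isThueMorseImageFrom (hs : EventuallyOverlapFree s) (k : ℕ) :
    ∃ p s', EventuallyOverlapFree s' ∧ IsThueMorseImageFrom k p s s' := by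
  induction k generalizing s with
  | zero => exact ⟨0, s, hs, .refl s⟩
  | succ k ih =>
    obtain ⟨q, hq⟩ := hs.exists_forall_ne
    have h_image : IsThueMorseImageFrom 1 q s fun n => s (q + 2 * n) :=
      IsThueMorseImageFrom.one_iff.2 fun n => ⟨rfl, Bool.eq_not.2 (hq n).symm⟩
    obtain ⟨p, s', hs', h⟩ := ih (hs.desubstitute h_image)
    exact ⟨q + 2 * p, s', hs', h_image.comp h⟩

theorem frequently_eq_false (hs : EventuallyOverlapFree s) : ∃ᶠ n in atTop, s n = false := by
  intro h
  obtain ⟨N, hN⟩ := eventually_atTop.1 ((hs 1 one_pos).and h)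
  have h_true : ∀ i, s (N + i) = true := fun i => by
    simpa using (hN (N + i) (Nat.le_add_right N i)).2
  refine (hN N le_rfl).1 fun k _ => ?_
  rw [Nat.add_assoc, h_true, h_true]

end EventuallyOverlapFree

theorem exists_consecutive_thueMorse :
    ∀ x y : Bool, ∃ m, thueMorse m = x ∧ thueMorse (m + 1) = y := by
  rintro (_ | _) (_ | _)
  exacts [⟨5, rfl, rfl⟩, ⟨0, rfl, rfl⟩, ⟨2, rfl, rfl⟩, ⟨1, rfl, rfl⟩]

theorem frequently_thueMorse_eq_false : ∃ᶠ n in atTop, thueMorse n = false := by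
  refine frequently_atTop.2 fun N => ?_
  cases h : thueMorse N
  · exact ⟨N, le_rfl, h⟩
  · exact ⟨2 * N + 1, by omega, by rw [thueMorse_two_mul_add_one, h]; rfl⟩

theorem factors_b3_subset_recurrentFactors {s : InfWord Bool}
    (h : ∀ k, ∃ p s', (∃ᶠ n in atTop, s' n = false) ∧ IsThueMorseImageFrom k p s s') :
    b3.factors ⊆ (diffWord s).recurrentFactors := by
  rintro u ⟨i, hi⟩
  rw [← diffWord_thueMorse] at hi
  set k := i + u.length + 1
  obtain ⟨p, s', hs', h⟩ := h k
  have hk : k < 2 ^ k := Nat.lt_two_pow_self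
  rw [InfWord.mem_recurrentFactors_iff, frequently_atTop]
  intro N
  obtain ⟨n, hn, hn_false⟩ := frequently_atTop.1 hs' N
  have hn_le : n ≤ 2 ^ k * n := Nat.le_mul_of_pos_left n (Nat.two_pow_pos k)
  refine ⟨p + (2 ^ k * n + i), by omega, hi.diffWord_congr fun j hj => ?_⟩
  have h_eq := (IsThueMorseImageFrom.thueMorse k).eq_of_eq (n := 0) h hn_false.symm
    (r := i + j) (by omega)
  convert h_eq using 2 <;> ring

theorem EventuallyOverlapFree.recurrentFactors_subset {s : InfWord Bool}
    (hs : EventuallyOverlapFree s) : (diffWord s).recurrentFactors ⊆ b3.factors := by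
  intro u hu
  set k := u.length + 1
  obtain ⟨p, s', -, h⟩ := hs.exists_isThueMorseImageFrom k
  have hk : k < 2 ^ k := Nat.lt_two_pow_self
  obtain ⟨i, hi, hu⟩ := frequently_atTop.1 (InfWord.mem_recurrentFactors_iff.1 hu) p
  obtain ⟨n, r, hr, rfl⟩ : ∃ n r, r < 2 ^ k ∧ i = p + (2 ^ k * n + r) :=
    ⟨(i - p) / 2 ^ k, (i - p) % 2 ^ k, Nat.mod_lt _ (by omega), by rw [Nat.div_add_mod]; omega⟩
  obtain ⟨m, hm, hm_succ⟩ := exists_consecutive_thueMorse (s' n) (s' (n + 1))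
  rw [← diffWord_thueMorse]
  refine ⟨2 ^ k * m + r, hu.diffWord_congr fun j hj => ?_⟩
  have h_eq := h.eq_of_eq_of_succ_eq (.thueMorse k) hm.symm hm_succ.symm (r := r + j) (by omega)
  convert h_eq using 2 <;> ring

theorem EventuallyOverlapFree.recurrentFactors_eq {s : InfWord Bool}
    (hs : EventuallyOverlapFree s) : (diffWord s).recurrentFactors = b3.factors :=
  hs.recurrentFactors_subset.antisymm <| factors_b3_subset_recurrentFactors fun k => by
    obtain ⟨p, s', hs', h⟩ := hs.exists_isThueMorseImageFrom k
    exact ⟨p, s', hs'.frequently_eq_false, h⟩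

theorem b3_recurrent : b3.Recurrent := by
  have h_subset : b3.factors ⊆ (diffWord thueMorse).recurrentFactors :=
    factors_b3_subset_recurrentFactors fun k =>
      ⟨0, thueMorse, frequently_thueMorse_eq_false, .thueMorse k⟩
  rwa [diffWord_thueMorse] at h_subset

/-- The bit that precedes the letter `w n` if `w` is the difference word of a binary word. -/
def precedingBit (w : InfWord (Fin 3)) : InfWord Bool :=
  fun n => decide (w n = 2 ∨ w n = 1 ∧ w (n + 1) = 2)

theorem diffLetter_precedingBit : ∀ a b c : Fin 3, a ≠ b → b ≠ c → ¬ (a = 0 ∧ b = 1 ∧ c = 0) →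
    ¬ (a = 2 ∧ b = 1 ∧ c = 2) →
    diffLetter (decide (a = 2 ∨ a = 1 ∧ b = 2)) (decide (b = 2 ∨ b = 1 ∧ c = 2)) = a := by
  decide

theorem eventually_diffWord_precedingBit {w : InfWord (Fin 3)}
    (h_square : ∀ c, [c, c] ∉ w.recurrentFactors)
    (h010 : [0, 1, 0] ∉ w.recurrentFactors) (h212 : [2, 1, 2] ∉ w.recurrentFactors) :
    ∀ᶠ i in atTop, diffWord (precedingBit w) i = w i := by
  have h_ne : ∀ᶠ i in atTop, w i ≠ w (i + 1) := by
    filter_upwards [eventually_all.2 fun c => InfWord.eventually_not_occursAt (h_square c)]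
      with i hi h
    exact hi (w i) (by simp [InfWord.occursAt_cons, InfWord.occursAt_nil, ← h])
  filter_upwards [h_ne, (tendsto_add_atTop_nat 1).eventually h_ne,
    InfWord.eventually_not_occursAt h010, InfWord.eventually_not_occursAt h212]
    with i hi hi_succ hi010 hi212
  simp only [InfWord.occursAt_cons, InfWord.occursAt_nil, and_true] at hi010 hi212
  exact diffLetter_precedingBit _ _ _ hi hi_succ hi010 hi212

theorem recurrentFactors_eq_of_squareFree {w : InfWord (Fin 3)}
    (h_square : ∀ u, u ++ u ∈ w.recurrentFactors → u = [])
    (h010 : [0, 1, 0] ∉ w.recurrentFactors) (h212 : [2, 1, 2] ∉ w.recurrentFactors) :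
    w.recurrentFactors = b3.recurrentFactors := by
  have h_diff := eventually_diffWord_precedingBit
    (fun c hc => List.cons_ne_nil c [] (h_square [c] hc)) h010 h212
  rw [← InfWord.recurrentFactors_congr h_diff, b3_recurrent.recurrentFactors_eq]
  refine EventuallyOverlapFree.recurrentFactors_eq fun p hp => ?_
  obtain ⟨N, hN⟩ := eventually_atTop.1 h_diff
  filter_upwards [w.eventually_factorAt_mem_recurrentFactors (p + p), eventually_ge_atTop N]
    with i hi hNi h_overlap
  have h_repeat : w.factorAt (i + p) p = w.factorAt i p := by
    refine congrArg List.ofFn (funext fun k => ?_)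
    rw [← hN (i + p + k) (by omega), ← hN (i + k) (by omega)]
    exact (congrArg₂ diffLetter (h_overlap k (by omega)) (h_overlap (k + 1) (by omega))).symm
  rw [InfWord.factorAt_add, h_repeat] at hi
  have h_length := w.length_factorAt i p
  rw [h_square _ hi, List.length_nil] at h_length
  omega

theorem InfWord.recurrentFactors_eq_map_symm {α β : Type*} (e : α ≃ β) {v : InfWord β}
    {w : InfWord α} (h : (w.map e).recurrentFactors = v.recurrentFactors) :
    w.recurrentFactors = (v.map e.symm).recurrentFactors := by
  ext u
  rw [mem_recurrentFactors_map, ← h, mem_recurrentFactors_map]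
  simp

theorem sigma_symm (c : Fin 3) : (sigma c).symm = sigma c :=
  Equiv.symm_swap _ _

theorem recurrentFactors_eq_map_sigma_of_avoids {w : InfWord (Fin 3)} (hw : w.Avoids formulaB)
    (c : Fin 3) (h010 : [0, 1, 0].map (sigma c) ∉ w.recurrentFactors)
    (h212 : [2, 1, 2].map (sigma c) ∉ w.recurrentFactors) :
    w.recurrentFactors = (b3.map (sigma c)).recurrentFactors := by
  rw [← sigma_symm c]
  rw [← sigma_symm c, ← InfWord.mem_recurrentFactors_map] at h010 h212
  exact InfWord.recurrentFactors_eq_map_symm _ <| recurrentFactors_eq_of_squareFree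
    (fun u hu => eq_nil_of_append_self_mem_recurrentFactors (hw.map _) hu) h010 h212

theorem exists_recurrentFactors_eq_of_avoids {w : InfWord (Fin 3)} (hw : w.Avoids formulaB) :
    ∃ v ∈ ({b3, b3.map (sigma 0), b3.map (sigma 2)} : Set (InfWord (Fin 3))),
      w.recurrentFactors = v.recurrentFactors := by
  rcases (formulaBFreeLanguage_recurrentFactors hw).exists_avoided_pair with
    ⟨h₁, h₂⟩ | ⟨h₁, h₂⟩ | ⟨h₁, h₂⟩
  · exact ⟨b3, by simp, recurrentFactors_eq_of_squareFree
      (fun u hu => eq_nil_of_append_self_mem_recurrentFactors hw hu) h₁ h₂⟩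
  · exact ⟨_, by simp, recurrentFactors_eq_map_sigma_of_avoids hw 0 h₁ h₂⟩
  · exact ⟨_, by simp, recurrentFactors_eq_map_sigma_of_avoids hw 2 h₁ h₂⟩

theorem thueMorse_eq_xor_bodd (n : ℕ) : thueMorse n = xor (thueMorse n.div2) n.bodd := by
  conv_lhs => rw [← Nat.bit_bodd_div2 n, thueMorse_bit]
  exact Bool.xor_comm _ _

theorem thueMorse_div2 (n : ℕ) : thueMorse n.div2 = xor (thueMorse n) n.bodd := by
  rw [thueMorse_eq_xor_bodd n, Bool.xor_assoc, Bool.xor_self, Bool.xor_false]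

theorem bodd_eq_true_of_thueMorse_eq {n : ℕ} (h : thueMorse n = thueMorse (n + 1)) :
    n.bodd = true := by
  by_contra hn
  rw [Bool.not_eq_true] at hn
  rw [thueMorse_eq_xor_bodd n, thueMorse_eq_xor_bodd (n + 1), Nat.bodd_succ, Nat.div2_succ, hn] at h
  simp at h

theorem not_thueMorse_eq_eq (n : ℕ) :
    ¬ (thueMorse n = thueMorse (n + 1) ∧ thueMorse (n + 1) = thueMorse (n + 2)) := by
  rintro ⟨h₁, h₂⟩
  have h_odd := bodd_eq_true_of_thueMorse_eq h₂
  rw [Nat.bodd_succ, bodd_eq_true_of_thueMorse_eq h₁] at h_odd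
  exact absurd h_odd (by decide)

theorem thueMorse_add_two_eq_iff (n : ℕ) :
    thueMorse n = thueMorse (n + 2) ↔ thueMorse n.div2 = thueMorse (n.div2 + 1) := by
  rw [thueMorse_eq_xor_bodd n, thueMorse_eq_xor_bodd (n + 2)]
  cases h : n.bodd <;> simp [Nat.bodd_succ, Nat.div2_succ, h]

theorem exists_thueMorse_eq_succ (n : ℕ) :
    ∃ i < 4, thueMorse (n + i) = thueMorse (n + (i + 1)) := by
  by_contra! h
  have h_trans : ∀ {x y z : Bool}, x ≠ y → y ≠ z → x = z := by decide
  have h_div2 : (n + 2).div2 = n.div2 + 1 := by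
    rw [Nat.div2_val, Nat.div2_val, Nat.add_div_right _ two_pos]
  refine not_thueMorse_eq_eq n.div2 ⟨?_, ?_⟩
  · exact (thueMorse_add_two_eq_iff n).1 (h_trans (h 0 (by decide)) (h 1 (by decide)))
  · have h_eq := (thueMorse_add_two_eq_iff (n + 2)).1 (h_trans (h 2 (by decide)) (h 3 (by decide)))
    rwa [h_div2] at h_eq

/-- The `l + 1` bits of the Thue–Morse word from position `m` on agree with those from position `n`
on. -/
def SameBits (l m n : ℕ) : Prop :=
  ∀ i ≤ l, thueMorse (m + i) = thueMorse (n + i)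

theorem SameBits.bodd_eq {l i m n : ℕ} (h : SameBits l m n) (hi : i < l)
    (hi' : thueMorse (n + i) = thueMorse (n + (i + 1))) : m.bodd = n.bodd := by
  have h_n := bodd_eq_true_of_thueMorse_eq hi'
  have h_m : (m + i).bodd = true :=
    bodd_eq_true_of_thueMorse_eq ((h i hi.le).trans (hi'.trans (h (i + 1) hi).symm))
  rw [Nat.bodd_add] at h_n h_m
  exact Bool.xor_left_inj.1 (h_m.trans h_n.symm)

theorem add_div2_eq {l m n : ℕ} (h : m.bodd = n.bodd) :
    (m + l).div2 = m.div2 + ((n + l).div2 - n.div2) := by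
  have h_m := Nat.bodd_add_div2 m
  have h_n := Nat.bodd_add_div2 n
  rw [h] at h_m
  simp only [Nat.div2_val] at h_m h_n ⊢
  omega

theorem SameBits.div2 {l m n : ℕ} (h : SameBits l m n) (h_bodd : m.bodd = n.bodd) :
    SameBits ((n + l).div2 - n.div2) m.div2 n.div2 := by
  intro i hi
  have h_m := Nat.bodd_add_div2 m
  have h_n := Nat.bodd_add_div2 n
  rcases Nat.eq_zero_or_pos i with rfl | hi₀
  · rw [Nat.add_zero, Nat.add_zero, thueMorse_div2, thueMorse_div2, h_bodd]
    exact congrArg (xor · n.bodd) (h 0 (Nat.zero_le _))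
  · have h_le := Bool.toNat_le n.bodd
    have h_div2 := Nat.div2_val (n + l)
    have h_bit := h (2 * i - n.bodd.toNat) (by omega)
    rwa [show m + (2 * i - n.bodd.toNat) = 2 * (m.div2 + i) by rw [← h_bodd] at h_le ⊢; omega,
      show n + (2 * i - n.bodd.toNat) = 2 * (n.div2 + i) by omega,
      thueMorse_two_mul, thueMorse_two_mul] at h_bit

instance : DecidableEq TVar := fun x y => by
  cases x <;> cases y <;> first | exact isTrue rfl | exact isFalse nofun

/-- A piece of a fragment located in the Thue–Morse word: two consecutive bits, or the image of a
variable, with its first and last bit. Consecutive pieces share a bit, since a word of `l` letters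
in the difference word `b₃` corresponds to `l + 1` bits. -/
inductive Block where
  | pair (a b : Bool)
  | var (x : TVar) (a b : Bool)
  deriving DecidableEq

/-- Positions in the Thue–Morse word and lengths, as words in `b₃`, of the images of the
variables. -/
structure Placement where
  pos : TVar → ℕ
  len : TVar → ℕ

namespace Placement

/-- The total length of the images, the measure of the infinite descent. -/
def size (π : Placement) : ℕ :=
  π.len .A + π.len .B + π.len .C

/-- The placement of the preimages of the images under the Thue–Morse substitution. -/
def div2 (π : Placement) : Placement where
  pos x := (π.pos x).div2
  len x := (π.pos x + π.len x).div2 - (π.pos x).div2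

/-- The image of `x` contains two equal consecutive bits, which fixes the parity of all its
positions, and has at least two letters, so that it gets shorter under desubstitution. -/
def IsLong (π : Placement) (x : TVar) : Prop :=
  2 ≤ π.len x ∧ ∃ i < π.len x, thueMorse (π.pos x + i) = thueMorse (π.pos x + (i + 1))

theorem len_div2_le (π : Placement) (x : TVar) : π.div2.len x ≤ π.len x := by
  simp only [div2, Nat.div2_val]
  omega

theorem IsLong.len_div2_lt {π : Placement} {x : TVar} (h : π.IsLong x) :
    π.div2.len x < π.len x := by
  have := h.1
  simp only [div2, Nat.div2_val]
  omega

theorem IsLong.len_div2_pos {π : Placement} {x : TVar} (h : π.IsLong x) : 0 < π.div2.len x := by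
  have := h.1
  simp only [div2, Nat.div2_val]
  omega

theorem IsLong.size_div2_lt {π : Placement} {x : TVar} (h : π.IsLong x) :
    π.div2.size < π.size := by
  have h_lt := h.len_div2_lt
  have hA := π.len_div2_le .A
  have hB := π.len_div2_le .B
  have hC := π.len_div2_le .C
  simp only [size]
  cases x <;> omega

end Placement

variable {π : Placement}

namespace Block

/-- The variable of a block. -/
def name : Block → Option TVar
  | pair _ _ => none
  | var x _ _ => some x

/-- The length of a block, as a word in `b₃`. -/
def length (π : Placement) : Block → ℕ
  | pair _ _ => 1
  | var x _ _ => π.len x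

/-- The block appears in the Thue–Morse word from position `n` on. -/
def OccursAt (π : Placement) : Block → ℕ → Prop
  | pair a b, n => thueMorse n = a ∧ thueMorse (n + 1) = b
  | var x a b, n => 0 < π.len x ∧ thueMorse n = a ∧ thueMorse (n + π.len x) = b ∧
      SameBits (π.len x) n (π.pos x)

/-- The factorizations into pairs of the images of a variable that are not long. -/
def shortWords : Block → List (List Block)
  | pair _ _ => []
  | var _ a b =>
    if a = b then [[pair a a], [pair a !a, pair (!a) a]]
    else [[pair a b], [pair a b, pair b a, pair a b]]

theorem OccursAt.length_pos {i : Block} {n : ℕ} (h : i.OccursAt π n) : 0 < i.length π := by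
  cases i with
  | pair => exact one_pos
  | var => exact h.1

theorem OccursAt.sameBits {i : Block} {m n : ℕ} (hm : i.OccursAt π m) (hn : i.OccursAt π n) :
    SameBits (i.length π) m n := by
  cases i with
  | pair a b =>
    intro k hk
    obtain rfl | rfl : k = 0 ∨ k = 1 := by simp only [length] at hk; omega
    exacts [hm.1.trans hn.1.symm, hm.2.trans hn.2.symm]
  | var x a b => exact fun k hk => (hm.2.2.2 k hk).trans (hn.2.2.2 k hk).symm

end Block

/-- The length of a list of blocks, as a word in `b₃`. -/
def blocksLength (π : Placement) (f : List Block) : ℕ :=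
  (f.map (·.length π)).sum

/-- The blocks appear one after the other in the Thue–Morse word from position `n` on. -/
def BlocksAt (π : Placement) : List Block → ℕ → Prop
  | [], _ => True
  | i :: f, n => i.OccursAt π n ∧ BlocksAt π f (n + i.length π)

theorem blocksAt_append {f g : List Block} {n : ℕ} :
    BlocksAt π (f ++ g) n ↔ BlocksAt π f n ∧ BlocksAt π g (n + blocksLength π f) := by
  induction f generalizing n with
  | nil => simp [BlocksAt, blocksLength]
  | cons i f ih => simp [BlocksAt, blocksLength, ih, and_assoc, Nat.add_assoc]

theorem BlocksAt.thueMorse_eq {f : List Block} {m n : ℕ} (hm : BlocksAt π f m)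
    (hn : BlocksAt π f n) : ∀ k < blocksLength π f,
      thueMorse (m + k) = thueMorse (n + k) ∧
        thueMorse (m + (k + 1)) = thueMorse (n + (k + 1)) := by
  induction f generalizing m n with
  | nil => simp [blocksLength]
  | cons i f ih =>
    intro k hk
    rw [blocksLength, List.map_cons, List.sum_cons, ← blocksLength] at hk
    rcases lt_or_ge k (i.length π) with hki | hki
    · exact ⟨hm.1.sameBits hn.1 k hki.le, hm.1.sameBits hn.1 (k + 1) hki⟩
    · obtain ⟨j, rfl⟩ := Nat.exists_eq_add_of_le hki
      simpa only [Nat.add_assoc] using ih hm.2 hn.2 j (by omega)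

theorem BlocksAt.flatMap {g : Block → List Block} {f : List Block} {n : ℕ}
    (hg : ∀ i ∈ f, ∀ n, i.OccursAt π n →
      BlocksAt π (g i) n ∧ blocksLength π (g i) = i.length π) (h : BlocksAt π f n) :
    BlocksAt π (f.flatMap g) n := by
  induction f generalizing n with
  | nil => trivial
  | cons i f ih =>
    rw [List.forall_mem_cons] at hg
    obtain ⟨h_at, h_length⟩ := hg.1 n h.1
    rw [List.flatMap_cons, blocksAt_append, h_length]
    exact ⟨h_at, ih hg.2 h.2⟩

theorem BlocksAt.exists_occursAt {f : List Block} {n : ℕ} (h : BlocksAt π f n) {i : Block}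
    (hi : i ∈ f) : ∃ m, i.OccursAt π m := by
  induction f generalizing n with
  | nil => cases hi
  | cons j f ih =>
    rcases List.mem_cons.1 hi with rfl | hi
    exacts [⟨n, h.1⟩, ih h.2 hi]

/-- Some nonempty word `v` of blocks is repeated in `f`, as `v ++ v`. -/
def hasSquare (f : List Block) : Bool :=
  f.tails.any (hasSquarePrefixFrom [])

theorem exists_square_of_hasSquare {f : List Block} (h : hasSquare f = true) :
    ∃ v ≠ [], v ++ v <:+: f := by
  obtain ⟨t, ht, h_square⟩ := List.any_eq_true.1 h
  obtain ⟨v, hv, hvt⟩ := exists_square_of_hasSquarePrefixFrom h_square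
  exact ⟨v, hv, hvt.isInfix.trans ((List.mem_tails _ _).1 ht).isInfix⟩

theorem BlocksAt.exists_of_infix {f g : List Block} {n : ℕ} (h : BlocksAt π f n) (hg : g <:+: f) :
    ∃ m, BlocksAt π g m := by
  obtain ⟨s, t, rfl⟩ := hg
  rw [blocksAt_append, blocksAt_append] at h
  exact ⟨_, h.1.2⟩

theorem BlocksAt.exists_b3_square {f : List Block} {n : ℕ} (hf : BlocksAt π f n)
    (h : hasSquare f = true) : ∃ u ≠ [], u ++ u ∈ b3.factors := by
  obtain ⟨v, hv, hvf⟩ := exists_square_of_hasSquare h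
  obtain ⟨m, hm⟩ := hf.exists_of_infix hvf
  rw [blocksAt_append] at hm
  have h_pos : 0 < blocksLength π v := by
    obtain ⟨i, v, rfl⟩ := List.exists_cons_of_ne_nil hv
    exact Nat.add_pos_left hm.1.1.length_pos _
  have h_eq : b3.factorAt m (blocksLength π v) =
      b3.factorAt (m + blocksLength π v) (blocksLength π v) := by
    refine congrArg List.ofFn (funext fun k => ?_)
    obtain ⟨h₀, h₁⟩ := hm.1.thueMorse_eq hm.2 k k.2
    rw [← diffWord_thueMorse]
    exact congrArg₂ diffLetter h₀ h₁
  refine ⟨_, List.ne_nil_of_length_pos ((b3.length_factorAt m _).trans_gt h_pos), m, ?_⟩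
  rw [InfWord.occursAt_append, b3.length_factorAt]
  exact ⟨b3.occursAt_factorAt _ _, h_eq ▸ b3.occursAt_factorAt _ _⟩

theorem Placement.len_lt_four_of_not_isLong {x : TVar} (h : ¬ π.IsLong x) : π.len x < 4 := by
  by_contra! h_len
  obtain ⟨i, hi, h_eq⟩ := exists_thueMorse_eq_succ (π.pos x)
  exact h ⟨by omega, i, by omega, h_eq⟩

theorem thueMorse_eq_not_of_not_isLong {x : TVar} (h : ¬ π.IsLong x) (h_two : 2 ≤ π.len x) {i : ℕ}
    (hi : i < π.len x) : thueMorse (π.pos x + (i + 1)) = !thueMorse (π.pos x + i) := by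
  by_contra h_eq
  exact h ⟨h_two, i, hi, (Bool.eq_not.not_left.1 h_eq).symm⟩

theorem Block.OccursAt.exists_shortWord {x : TVar} {a b : Bool} {n : ℕ}
    (h : (var x a b).OccursAt π n) (h_short : ¬ π.IsLong x) :
    ∃ c ∈ (var x a b).shortWords, blocksLength π c = π.len x ∧
      ∀ m, (var x a b).OccursAt π m → BlocksAt π c m := by
  have h_len := Placement.len_lt_four_of_not_isLong h_short
  have h_bits : ∀ m, (var x a b).OccursAt π m → ∀ i ≤ π.len x,
    thueMorse (m + i) = thueMorse (n + i) := fun m hm => hm.sameBits h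
  have h_alt : 2 ≤ π.len x → ∀ i < π.len x, thueMorse (n + (i + 1)) = !thueMorse (n + i) :=
    fun h_two i hi => by
      rw [h.2.2.2 i hi.le, h.2.2.2 (i + 1) hi, thueMorse_eq_not_of_not_isLong h_short h_two hi]
  obtain ⟨h_pos, rfl, rfl, -⟩ := h
  obtain hl | hl | hl : π.len x = 1 ∨ π.len x = 2 ∨ π.len x = 3 := by omega
  all_goals rw [hl] at h_bits h_alt ⊢
  · refine ⟨[pair (thueMorse n) (thueMorse (n + 1))], ?_, rfl, fun m hm => ?_⟩
    · cases thueMorse n <;> cases thueMorse (n + 1) <;> simp [shortWords]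
    · exact ⟨⟨h_bits m hm 0 (by decide), h_bits m hm 1 le_rfl⟩, trivial⟩
  · have h₁ : thueMorse (n + 1) = !thueMorse n := h_alt le_rfl 0 (by decide)
    have h₂ : thueMorse (n + 2) = thueMorse n := by
      rw [h_alt le_rfl 1 (by decide), h₁, Bool.not_not]
    refine ⟨[pair (thueMorse n) (!thueMorse n), pair (!thueMorse n) (thueMorse n)], ?_, rfl,
      fun m hm => ?_⟩
    · simp [shortWords, h₂]
    · have hm₁ := (h_bits m hm 1 (by decide)).trans h₁
      exact ⟨⟨h_bits m hm 0 (by decide), hm₁⟩, ⟨hm₁, (h_bits m hm 2 le_rfl).trans h₂⟩, trivial⟩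
  · have h₁ : thueMorse (n + 1) = !thueMorse n := h_alt (by decide) 0 (by decide)
    have h₂ : thueMorse (n + 2) = thueMorse n := by
      rw [h_alt (by decide) 1 (by decide), h₁, Bool.not_not]
    have h₃ : thueMorse (n + 3) = !thueMorse n := by rw [h_alt (by decide) 2 (by decide), h₂]
    refine ⟨[pair (thueMorse n) (!thueMorse n), pair (!thueMorse n) (thueMorse n),
      pair (thueMorse n) (!thueMorse n)], ?_, rfl, fun m hm => ?_⟩
    · simp [shortWords, h₃]
    · have hm₁ := (h_bits m hm 1 (by decide)).trans h₁
      have hm₂ := (h_bits m hm 2 (by decide)).trans h₂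
      exact ⟨⟨h_bits m hm 0 (by decide), hm₁⟩, ⟨hm₁, hm₂⟩,
        ⟨hm₂, (h_bits m hm 3 le_rfl).trans h₃⟩, trivial⟩

/-- The function on the variables with the values `u`, `v` and `w`. -/
def TVar.elim {β : Type*} (u v w : β) : TVar → β
  | A => u
  | B => v
  | C => w

theorem TVar.elim_eq {β : Type*} (g : TVar → β) : elim (g A) (g B) (g C) = g :=
  funext (by rintro ⟨⟩ <;> rfl)

/-- Simultaneous fragments of blocks, to be located in the Thue–Morse word. -/
abbrev BlockFormula := List (List Block)

namespace BlockFormula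

/-- The variables that appear in a block formula. -/
def vars (S : BlockFormula) : List TVar :=
  (S.flatten.filterMap Block.name).dedup

/-- Every fragment appears in the Thue–Morse word. -/
def RealizedBy (S : BlockFormula) (π : Placement) : Prop :=
  ∀ f ∈ S, ∃ n, BlocksAt π f n

/-- Some placement of size less than `m` realizes the block formula. -/
def RealizedBelow (S : BlockFormula) (m : ℕ) : Prop :=
  ∃ π : Placement, π.size < m ∧ S.RealizedBy π

/-- The block formula with the block `i` replaced by the blocks of `c`. -/
def subst (S : BlockFormula) (i : Block) (c : List Block) : BlockFormula :=
  S.map (·.flatMap fun j => if j = i then c else [j])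

/-- The preimage of a list of blocks under the Thue–Morse substitution, if there is one; `q x` holds
the parities of the first and last position of `x`, and the last argument is the parity of the first
position of the list. A pair at an even position lies inside the image of one bit and disappears. -/
def desubstitute (q : TVar → Bool × Bool) : List Block → Bool → Option (List Block)
  | [], _ => some []
  | .pair a b :: f, false => if a = b then none else desubstitute q f true
  | .pair a b :: f, true => (desubstitute q f false).map (.pair (!a) b :: ·)
  | .var x a b :: f, p =>
    if (q x).1 = p then (desubstitute q f (q x).2).map (.var x (xor a p) (xor b (q x).2) :: ·)
    else none

/-- The preimages of a list of blocks for both parities of its first position. -/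
def preimages (q : TVar → Bool × Bool) (f : List Block) : List (List Block) :=
  [false, true].filterMap (desubstitute q f)

/-- The four pairs of bits. -/
def bitPairs : List (Bool × Bool) :=
  [(false, false), (false, true), (true, false), (true, true)]

/-- The choices of the parities of the first and last positions of the variables, normalized to
`(false, false)` at the variables that do not appear. -/
def parities (S : BlockFormula) : List (TVar → Bool × Bool) :=
  let choices : TVar → List (Bool × Bool) := fun x =>
    if x ∈ S.vars then bitPairs else [(false, false)]
  (choices .A).flatMap fun u => (choices .B).flatMap fun v => (choices .C).map (TVar.elim u v)

theorem mem_vars {S : BlockFormula} {f : List Block} (hf : f ∈ S) {x : TVar} {a b : Bool}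
    (hx : .var x a b ∈ f) : x ∈ S.vars :=
  List.mem_dedup.2 (List.mem_filterMap.2 ⟨_, List.mem_flatten.2 ⟨f, hf, hx⟩, rfl⟩)

theorem exists_var_of_mem_vars {S : BlockFormula} {x : TVar} (hx : x ∈ S.vars) :
    ∃ f ∈ S, ∃ a b, .var x a b ∈ f := by
  obtain ⟨i, hi, hix⟩ := List.mem_filterMap.1 (List.mem_dedup.1 hx)
  obtain ⟨f, hf, hif⟩ := List.mem_flatten.1 hi
  cases i with
  | pair a b => cases hix
  | var y a b =>
    obtain rfl : y = x := Option.some_injective _ hix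
    exact ⟨f, hf, a, b, hif⟩

theorem RealizedBy.subst {S : BlockFormula} (h : S.RealizedBy π) {i : Block} {c : List Block}
    (hc : ∀ n, i.OccursAt π n → BlocksAt π c n ∧ blocksLength π c = i.length π) :
    (S.subst i c).RealizedBy π := by
  rw [RealizedBy, BlockFormula.subst, List.forall_mem_map]
  intro f hf
  obtain ⟨n, hn⟩ := h f hf
  refine ⟨n, hn.flatMap fun j _ m hm => ?_⟩
  split_ifs with hj
  · subst hj
    exact hc m hm
  · exact ⟨⟨hm, trivial⟩, by simp [blocksLength]⟩

theorem desubstitute_of_blocksAt {q : TVar → Bool × Bool} {f : List Block} {n : ℕ}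
    (hq : ∀ x a b, .var x a b ∈ f →
      π.IsLong x ∧ q x = ((π.pos x).bodd, (π.pos x + π.len x).bodd))
    (h : BlocksAt π f n) :
    ∃ f', desubstitute q f n.bodd = some f' ∧ BlocksAt π.div2 f' n.div2 := by
  induction f generalizing n with
  | nil => exact ⟨[], rfl, trivial⟩
  | cons i f ih =>
    obtain ⟨hi, hf⟩ := h
    obtain ⟨f', hf', hn⟩ := ih (fun x a b hx => hq x a b (List.mem_cons_of_mem _ hx)) hf
    match i with
    | .pair a b =>
      obtain ⟨rfl, rfl⟩ := hi
      rw [Block.length, Nat.bodd_succ] at hf'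
      rw [Block.length, Nat.div2_succ] at hn
      cases hp : n.bodd <;> rw [hp] at hf' hn
      · refine ⟨f', ?_, hn⟩
        rw [desubstitute, if_neg]
        · exact hf'
        · intro h_eq
          rw [bodd_eq_true_of_thueMorse_eq h_eq] at hp
          cases hp
      · refine ⟨.pair (!thueMorse n) (thueMorse (n + 1)) :: f', ?_, ⟨?_, ?_⟩, hn⟩
        · rw [Bool.not_true] at hf'
          rw [desubstitute, hf']
          rfl
        · rw [thueMorse_div2, hp, Bool.xor_true]
        · have := thueMorse_div2 (n + 1)
          simpa [Nat.div2_succ, Nat.bodd_succ, hp] using this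
    | .var x a b =>
      obtain ⟨h_long, hqx⟩ := hq x a b List.mem_cons_self
      obtain ⟨-, rfl, rfl, h_bits⟩ := hi
      obtain ⟨k, hk, h_eq⟩ := h_long.2
      have h_bodd := h_bits.bodd_eq hk h_eq
      have h_last : (n + π.len x).bodd = (q x).2 := by
        rw [hqx, Nat.bodd_add, Nat.bodd_add, h_bodd]
      have h_div2 : (n + π.len x).div2 = n.div2 + π.div2.len x := add_div2_eq h_bodd
      rw [Block.length, h_last] at hf'
      rw [Block.length, h_div2] at hn
      refine ⟨.var x (xor (thueMorse n) n.bodd) (xor (thueMorse (n + π.len x)) (q x).2) :: f', ?_,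
        ⟨h_long.len_div2_pos, ?_, ?_, h_bits.div2 h_bodd⟩, hn⟩
      · rw [desubstitute, if_pos (by rw [hqx, h_bodd]), hf']
        rfl
      · exact thueMorse_div2 n
      · rw [← h_div2, ← h_last, thueMorse_div2]

theorem mem_parities {S : BlockFormula} {q : TVar → Bool × Bool}
    (hq : ∀ x, x ∉ S.vars → q x = (false, false)) : q ∈ S.parities := by
  have h_mem : ∀ x, q x ∈ if x ∈ S.vars then bitPairs else [(false, false)] := by
    intro x
    split_ifs with hx
    · generalize q x = v
      revert v
      decide
    · exact List.mem_singleton.2 (hq x hx)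
  simp only [parities, List.mem_flatMap, List.mem_map]
  exact ⟨_, h_mem .A, _, h_mem .B, _, h_mem .C, TVar.elim_eq q⟩

theorem exists_mem_sections_map {α β : Type*} {P : β → Prop} {g : α → List β} {l : List α}
    (h : ∀ a ∈ l, ∃ b ∈ g a, P b) : ∃ F ∈ (l.map g).sections, ∀ b ∈ F, P b := by
  induction l with
  | nil => exact ⟨[], by simp, by simp⟩
  | cons a l ih =>
    rw [List.forall_mem_cons] at h
    obtain ⟨b, hb, hPb⟩ := h.1
    obtain ⟨F, hF, hPF⟩ := ih h.2
    rw [List.mem_sections] at hF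
    exact ⟨b :: F, List.mem_sections.2 (.cons hb hF), List.forall_mem_cons.2 ⟨hPb, hPF⟩⟩

theorem RealizedBy.exists_div2 {S : BlockFormula} (h : S.RealizedBy π)
    (h_long : ∀ x ∈ S.vars, π.IsLong x) :
    ∃ q ∈ S.parities, ∃ F ∈ (S.map (preimages q)).sections, RealizedBy F π.div2 := by
  classical
  let q : TVar → Bool × Bool := fun x =>
    if x ∈ S.vars then ((π.pos x).bodd, (π.pos x + π.len x).bodd) else (false, false)
  refine ⟨q, mem_parities fun x hx => if_neg hx, exists_mem_sections_map fun f hf => ?_⟩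
  obtain ⟨n, hn⟩ := h f hf
  obtain ⟨f', hf', hn'⟩ := desubstitute_of_blocksAt (q := q)
    (fun x a b hx => ⟨h_long x (mem_vars hf hx), if_pos (mem_vars hf hx)⟩) hn
  exact ⟨f', List.mem_filterMap.2 ⟨n.bodd, by cases n.bodd <;> simp, hf'⟩, _, hn'⟩

theorem RealizedBy.exists_subst {S : BlockFormula} (h : S.RealizedBy π)
    {x : TVar} (hx : x ∈ S.vars) (h_short : ¬ π.IsLong x) :
    ∃ i ∈ S.flatten.dedup, ∃ c ∈ i.shortWords, (S.subst i c).RealizedBy π := by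
  obtain ⟨f, hf, a, b, hi⟩ := exists_var_of_mem_vars hx
  obtain ⟨n, hn⟩ := h f hf
  obtain ⟨m, hm⟩ := hn.exists_occursAt hi
  obtain ⟨c, hc, h_length, h_at⟩ := hm.exists_shortWord h_short
  exact ⟨_, List.mem_dedup.2 (List.mem_flatten.2 ⟨f, hf, hi⟩), c, hc,
    h.subst fun k hk => ⟨h_at k hk, h_length⟩⟩

end BlockFormula

/-- Evaluates `k a` after a case distinction on the bit `a`. -/
def forceBool {β : Type*} (a : Bool) (k : Bool → β) : β :=
  match a with
  | true => k true
  | false => k false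

/-- Evaluates `k x` after a case distinction on the variable `x`. -/
def TVar.force {β : Type*} (x : TVar) (k : TVar → β) : β :=
  match x with
  | A => k A
  | B => k B
  | C => k C

/-- Evaluates `k i` after normalizing the block `i`. -/
def Block.force {β : Type*} (i : Block) (k : Block → β) : β :=
  match i with
  | pair a b => forceBool a fun a => forceBool b fun b => k (pair a b)
  | var x a b => x.force fun x => forceBool a fun a => forceBool b fun b => k (var x a b)

/-- Evaluates `k l` after normalizing the members of `l` by `force`. -/
def forceList {α β : Type*} (force : α → (α → β) → β) : List α → (List α → β) → β
  | [], k => k []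
  | a :: l, k => force a fun a => forceList force l fun l => k (a :: l)

theorem Block.force_eq {β : Type*} (i : Block) (k : Block → β) : i.force k = k i := by
  rcases i with ⟨a, b⟩ | ⟨x, a, b⟩
  · cases a <;> cases b <;> rfl
  · cases x <;> cases a <;> cases b <;> rfl

theorem forceList_eq {α β : Type*} {force : α → (α → β) → β} (hf : ∀ a k, force a k = k a)
    (l : List α) (k : List α → β) : forceList force l k = k l := by
  induction l generalizing k with
  | nil => rfl
  | cons a l ih => rw [forceList, hf, ih]

namespace BlockFormula

/-- Search for a proof, of depth less than the second argument, that a block formula has no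
realization. A formula is refuted if `prune` rejects one of its fragments, or if it is among the
formulas `anc` from which it was obtained by desubstitution, as the realization then gets smaller
and smaller. Otherwise either some variable is short and can be replaced by pairs, or all of them
are long and the formula can be desubstituted.

The formula is normalized first: the kernel evaluates by name, and would otherwise compute its
blocks again at each use. -/
def refute (prune : List Block → Bool) : ℕ → List BlockFormula → BlockFormula → Bool
  | 0, _, _ => false
  | n + 1, anc, S => forceList (forceList Block.force) S fun S : BlockFormula =>
    S.any prune || anc.contains S ||
      (S.flatten.dedup.all fun i => i.shortWords.all fun c => refute prune n [] (S.subst i c)) &&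
      S.parities.all fun q => (S.map (preimages q)).sections.all <|
        refute prune n (if S.vars = [] then [] else S :: anc)

theorem refute_succ {prune : List Block → Bool} {n : ℕ} {anc : List BlockFormula}
    {S : BlockFormula} (h : refute prune (n + 1) anc S = true) :
    (∃ f ∈ S, prune f = true) ∨ S ∈ anc ∨
      (∀ i ∈ S.flatten.dedup, ∀ c ∈ i.shortWords, refute prune n [] (S.subst i c) = true) ∧
      ∀ q ∈ S.parities, ∀ F ∈ (S.map (preimages q)).sections,
        refute prune n (if S.vars = [] then [] else S :: anc) F = true := by
  rw [refute, forceList_eq (forceList_eq Block.force_eq)] at h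
  simpa only [Bool.or_eq_true, Bool.and_eq_true, List.any_eq_true, List.all_eq_true,
    List.contains_iff_mem, or_assoc] using h

theorem RealizedBelow.mono {S : BlockFormula} {m n : ℕ} (h : S.RealizedBelow m) (hmn : m ≤ n) :
    S.RealizedBelow n :=
  h.imp fun _ hπ => ⟨hπ.1.trans_le hmn, hπ.2⟩

theorem not_realizedBelow_of_refute {prune : List Block → Bool}
    (h_prune : ∀ {π f n}, prune f = true → ¬ BlocksAt π f n) {n m : ℕ} {anc : List BlockFormula}
    {S : BlockFormula} (h : refute prune n anc S = true)
    (h_anc : ∀ T ∈ anc, ¬ T.RealizedBelow m) : ¬ S.RealizedBelow m := by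
  induction n generalizing m anc S with
  | zero => cases h
  | succ n ihn =>
    induction m with
    | zero => exact fun ⟨_, h_size, _⟩ => Nat.not_lt_zero _ h_size
    | succ m ihm =>
      have h_anc' : ∀ T ∈ S :: anc, ¬ T.RealizedBelow m :=
        have h_anc' T hT hm := h_anc T hT (hm.mono m.le_succ)
        List.forall_mem_cons.2 ⟨ihm h_anc', h_anc'⟩
      rintro ⟨π, h_size, hπ⟩
      rcases refute_succ h with ⟨f, hf, hf'⟩ | hS | ⟨h_subst, h_div2⟩
      · obtain ⟨k, hk⟩ := hπ f hf
        exact h_prune hf' hk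
      · exact h_anc S hS ⟨π, h_size, hπ⟩
      by_cases h_long : ∀ x ∈ S.vars, π.IsLong x
      · obtain ⟨q, hq, F, hF, hπF⟩ := hπ.exists_div2 h_long
        have hF' := h_div2 q hq F hF
        split_ifs at hF' with h_vars
        · exact ihn hF' (by simp) ⟨π.div2, Nat.lt_succ_self _, hπF⟩
        · obtain ⟨x, hx⟩ := List.exists_mem_of_ne_nil _ h_vars
          have h_lt := (h_long x hx).size_div2_lt
          exact ihn hF' h_anc' ⟨π.div2, by omega, hπF⟩
      · push Not at h_long
        obtain ⟨x, hx, h_short⟩ := h_long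
        obtain ⟨i, hi, c, hc, hπc⟩ := hπ.exists_subst hx h_short
        exact ihn (h_subst i hi c hc) (by simp) ⟨π, h_size, hπc⟩

/-- The blocks of the image of a word of variables whose first bit is the last argument: `o x` holds
the first and last bit of `x`, and is `none` if the image of `x` is the letter `1`, which does not
determine its bits. -/
def label (o : TVar → Option (Bool × Bool)) : List TVar → Bool → Option (List Block)
  | [], _ => some []
  | x :: p, v => match o x with
    | none => (label o p v).map (.pair v v :: ·)
    | some (a, b) => if a = v then (label o p b).map (.var x a b :: ·) else none

/-- The block formulas of a formula, for given bits `o` of the variables. -/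
def labelings (o : TVar → Option (Bool × Bool)) (f : Formula TVar) : List BlockFormula :=
  (f.map fun p => [false, true].filterMap (label o p)).sections

/-- Refutes all block formulas of a formula. -/
def refuteFormula (prune : List Block → Bool) (f : Formula TVar) : Bool :=
  let choices := none :: bitPairs.map some
  choices.all fun u => choices.all fun v => choices.all fun w =>
    (labelings (TVar.elim u v w) f).all (refute prune 20 [])

end BlockFormula

theorem b3_eq_one_iff (n : ℕ) : b3 n = 1 ↔ thueMorse n = thueMorse (n + 1) := by
  have h_letter : ∀ a b : Bool, diffLetter a b = 1 ↔ a = b := by decide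
  rw [← diffWord_thueMorse]
  exact h_letter _ _

theorem exists_b3_ne_one {u : List (Fin 3)} {n : ℕ} (hn : b3.OccursAt u n) (hu : u ≠ [])
    (hu_one : u ≠ [1]) : ∃ k < u.length, b3 (n + k) ≠ 1 := by
  match u with
  | [a] =>
    refine ⟨0, Nat.zero_lt_one, fun h => hu_one ?_⟩
    rw [← (InfWord.occursAt_cons.1 hn).1, ← h]
    rfl
  | a :: b :: u =>
    by_contra! h
    exact not_thueMorse_eq_eq n
      ⟨(b3_eq_one_iff _).1 (h 0 (by simp)), (b3_eq_one_iff _).1 (h 1 (by simp))⟩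

/-- A letter of `b₃` tells whether the bit changes, and a letter other than `1` also tells the
bit. -/
theorem sameBits_of_occursAt {u : List (Fin 3)} {m n : ℕ} (hm : b3.OccursAt u m)
    (hn : b3.OccursAt u n) (hu : u ≠ []) (hu_one : u ≠ [1]) : SameBits u.length m n := by
  have h_letter : ∀ k < u.length, diffLetter (thueMorse (m + k)) (thueMorse (m + (k + 1))) =
      diffLetter (thueMorse (n + k)) (thueMorse (n + (k + 1))) := by
    rw [← diffWord_thueMorse, diffWord_occursAt_iff] at hm hn
    exact fun k hk => (hm k hk).trans (hn k hk).symm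
  have h_step : ∀ a b c d : Bool, diffLetter a b = diffLetter c d → (b = d ↔ a = c) := by decide
  have h_fix : ∀ a b c d : Bool, diffLetter a b = diffLetter c d → a ≠ b → a = c := by decide
  have h_iff : ∀ i ≤ u.length,
      thueMorse (m + i) = thueMorse (n + i) ↔ thueMorse m = thueMorse n := by
    intro i
    induction i with
    | zero => exact fun _ => Iff.rfl
    | succ i ih => exact fun hi => (h_step _ _ _ _ (h_letter i hi)).trans (ih (by omega))
  obtain ⟨k, hk, hk_one⟩ := exists_b3_ne_one hm hu hu_one
  rw [Ne, b3_eq_one_iff] at hk_one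
  exact fun i hi =>
    (h_iff i hi).2 ((h_iff k hk.le).1 (h_fix _ _ _ _ (h_letter k hk) hk_one))

namespace BlockFormula

/-- The morphism `h` with the position `N x` of an occurrence of `h x` for each variable `x`, as a
placement. -/
def placement (h : TVar → List (Fin 3)) (N : TVar → ℕ) : Placement where
  pos := N
  len x := (h x).length

/-- The first and last bit of the occurrences `N x` of the images `h x ≠ [1]`. -/
def bits (h : TVar → List (Fin 3)) (N : TVar → ℕ) (x : TVar) : Option (Bool × Bool) :=
  if h x = [1] then none else some (thueMorse (N x), thueMorse (N x + (h x).length))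

theorem exists_label_of_occursAt {h : TVar → List (Fin 3)} {N : TVar → ℕ} (hh : ∀ x, h x ≠ [])
    (hN : ∀ x, h x ∈ b3.factors → b3.OccursAt (h x) (N x)) {p : List TVar} {n : ℕ}
    (hp : b3.OccursAt (morphImage h p) n) :
    ∃ f, label (bits h N) p (thueMorse n) = some f ∧ BlocksAt (placement h N) f n := by
  induction p generalizing n with
  | nil => exact ⟨[], rfl, trivial⟩
  | cons x p ih =>
    obtain ⟨hx, hp⟩ := InfWord.occursAt_append.1
      (show b3.OccursAt (h x ++ morphImage h p) n from hp)
    obtain ⟨f, hf, h_at⟩ := ih hp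
    by_cases h_one : h x = [1]
    · rw [h_one] at hx hf h_at
      have h_eq := (b3_eq_one_iff n).1 (InfWord.occursAt_cons.1 hx).1
      refine ⟨.pair (thueMorse n) (thueMorse n) :: f, ?_, ⟨rfl, h_eq.symm⟩, h_at⟩
      rw [label, bits, if_pos h_one]
      rw [h_eq]
      exact congrArg (Option.map _) hf
    · have h_bits : SameBits (h x).length n (N x) :=
        sameBits_of_occursAt hx (hN x ⟨n, hx⟩) (hh x) h_one
      refine ⟨.var x (thueMorse n) (thueMorse (n + (h x).length)) :: f, ?_,
        ⟨List.length_pos_of_ne_nil (hh x), rfl, rfl, h_bits⟩, h_at⟩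
      rw [label, bits, if_neg h_one]
      have h_last := h_bits _ le_rfl
      have h_first := h_bits 0 (Nat.zero_le _)
      simp only [Nat.add_zero] at h_first
      simp only [← h_first, ← h_last, if_true, hf, Option.map_some]

theorem b3_avoids_of_refuteFormula {prune : List Block → Bool}
    (h_prune : ∀ {π f n}, prune f = true → ¬ BlocksAt π f n) {f : Formula TVar}
    (hf : refuteFormula prune f = true) : b3.Avoids f := by
  rintro ⟨h, hh, h_factors⟩
  let N : TVar → ℕ := fun x => Classical.epsilon (b3.OccursAt (h x))
  have hN : ∀ x, h x ∈ b3.factors → b3.OccursAt (h x) (N x) := fun x => Classical.epsilon_spec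
  obtain ⟨S, hS, hS_at⟩ : ∃ S ∈ labelings (bits h N) f, RealizedBy S (placement h N) := by
    refine exists_mem_sections_map fun p hp => ?_
    obtain ⟨n, hn⟩ := h_factors p hp
    obtain ⟨f, hf, h_at⟩ := exists_label_of_occursAt hh hN hn
    exact ⟨f, List.mem_filterMap.2 ⟨thueMorse n, by cases thueMorse n <;> simp, hf⟩, n, h_at⟩
  have h_bits : ∀ x, bits h N x ∈ none :: bitPairs.map some := by
    intro x
    generalize bits h N x = v
    revert v
    decide
  simp only [refuteFormula, List.all_eq_true] at hf
  have h_refute := hf _ (h_bits .A) _ (h_bits .B) _ (h_bits .C) S (by rwa [TVar.elim_eq])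
  exact not_realizedBelow_of_refute h_prune h_refute (by simp)
    ⟨placement h N, Nat.lt_succ_self _, hS_at⟩

end BlockFormula

open BlockFormula

theorem b3_squarefree {u : List (Fin 3)} (hu : u ≠ []) : u ++ u ∉ b3.factors := by
  intro h_square
  have h_avoids : b3.Avoids [[A, A]] :=
    b3_avoids_of_refuteFormula (prune := fun _ => false) (fun h => by cases h) (by decide +kernel)
  refine h_avoids ⟨fun _ => u, fun _ => hu, List.forall_mem_singleton.2 ?_⟩
  simpa [morphImage] using h_square

theorem not_blocksAt_of_hasSquare {π : Placement} {f : List Block} {n : ℕ}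
    (h : hasSquare f = true) : ¬ BlocksAt π f n := by
  intro hf
  obtain ⟨u, hu, h_square⟩ := hf.exists_b3_square h
  exact b3_squarefree hu h_square

theorem b3_avoids_formula1 : b3.Avoids formula1 :=
  b3_avoids_of_refuteFormula not_blocksAt_of_hasSquare (by decide +kernel)

theorem b3_avoids_formula2 : b3.Avoids formula2 :=
  b3_avoids_of_refuteFormula not_blocksAt_of_hasSquare (by decide +kernel)

theorem b3_avoids_formula3 : b3.Avoids formula3 :=
  b3_avoids_of_refuteFormula not_blocksAt_of_hasSquare (by decide +kernel)

theorem b3_avoids_formula4 : b3.Avoids formula4 :=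
  b3_avoids_of_refuteFormula not_blocksAt_of_hasSquare (by decide +kernel)

theorem exists_infix_formulaB {f : Formula TVar}
    (hf : f ∈ ({formulaB, formula1, formula2, formula3, formula4} : Set (Formula TVar))) :
    ∀ p ∈ f, ∃ q ∈ formulaB, p <:+: q := by
  rcases hf with rfl | rfl | rfl | rfl | rfl <;> decide

theorem b3_avoids {f : Formula TVar}
    (hf : f ∈ ({formulaB, formula1, formula2, formula3, formula4} : Set (Formula TVar))) :
    b3.Avoids f := by
  rcases hf with rfl | rfl | rfl | rfl | rfl
  · exact b3_avoids_formula2.of_forall_exists_infix (by decide)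
  exacts [b3_avoids_formula1, b3_avoids_formula2, b3_avoids_formula3, b3_avoids_formula4]

theorem theorem2 (f : Formula TVar)
    (hf : f ∈ ({formulaB, formula1, formula2, formula3, formula4} : Set (Formula TVar))) :
    (∀ w : InfWord (Fin 3), w.Recurrent → w.Avoids f →
      w.Equivalent b3 ∨ w.Equivalent (b3.map (sigma 0)) ∨ w.Equivalent (b3.map (sigma 2))) ∧
    (∀ v ∈ ({b3, b3.map (sigma 0), b3.map (sigma 2)} : Set (InfWord (Fin 3))),
      v.Recurrent ∧ v.Avoids f) ∧
    (∀ w : InfWord (Fin 3), w.Avoids f →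
      ∃ v ∈ ({b3, b3.map (sigma 0), b3.map (sigma 2)} : Set (InfWord (Fin 3))),
        w.recurrentFactors = v.recurrentFactors) := by
  have h_words : ∀ v ∈ ({b3, b3.map (sigma 0), b3.map (sigma 2)} : Set (InfWord (Fin 3))),
      v.Recurrent ∧ v.Avoids f := by
    rintro _ (rfl | rfl | rfl)
    exacts [⟨b3_recurrent, b3_avoids hf⟩, ⟨b3_recurrent.map _, (b3_avoids hf).map _⟩,
      ⟨b3_recurrent.map _, (b3_avoids hf).map _⟩]
  have h_factors : ∀ w : InfWord (Fin 3), w.Avoids f →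
      ∃ v ∈ ({b3, b3.map (sigma 0), b3.map (sigma 2)} : Set (InfWord (Fin 3))),
        w.recurrentFactors = v.recurrentFactors := fun w hw =>
    exists_recurrentFactors_eq_of_avoids (hw.of_forall_exists_infix (exists_infix_formulaB hf))
  refine ⟨fun w hw h_avoids => ?_, h_words, h_factors⟩
  obtain ⟨v, hv, h_eq⟩ := h_factors w h_avoids
  rw [hw.recurrentFactors_eq, (h_words v hv).1.recurrentFactors_eq] at h_eq
  rcases hv with rfl | rfl | rfl
  exacts [.inl h_eq, .inr (.inl h_eq), .inr (.inr h_eq)]
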